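/- A weight is a non-negative locally integrable function $w$ on $\mathbb{R}$. Let $$M^+f(x)=\sup_{h>0}\frac1h\int_x^{x+h}|f(y)|\,dy ,$$ for $1<p<\infty$ let $$[w]_{A_p^+}=\sup_{a<b<c}\frac1{c-a}\int_a^b w\left(\frac1{c-a}\int_b^c w^{-\frac1{p-1}}\right)^{p-1},$$ and say that $w\in A_p^+$ if $[w]_{A_p^+}<\infty$. For a measurable $\sigma\colon\mathbb{R}\to[0,\infty]$ let $$[\sigma]_{A_\infty^-}=\sup_I\frac1{\sigma(I)}\int_I M^+(\chi_I\sigma),\qquad \sigma(I)=\int_I\sigma,$$ the supremum being over bounded intervals $I$ with $0<\sigma(I)<\infty$ (here $0^{-s}=\infty$ for $s>0$, $0\cdot\infty=0$, $\sup\emptyset=0$). The weighted Lorentz space $L^{p,q}(w)$ consists of the measurable functions $f$ with $\|f\|_{L^{p,q}(w)}<\infty$, where, with $w(E)=\int_E w$, $$\|f\|_{L^{p,q}(w)}=\left(p\int_0^\infty\left(t\,w(\{|f|>t\})^{1/p}\right)^q\frac{dt}{t}\right)^{1/q}\ (0<q<\infty),\qquad \|f\|_{L^{p,\infty}(w)}=\sup_{t>0}t\,w(\{|f|>t\})^{1/p}.$$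 Theorem. Let $1<p<\infty$ and $0<q\le\infty$. There is a constant $C$ depending only on $p$ and $q$ such that for every weight $w\in A_p^+$, with $\sigma=w^{1-p'}$ and $p'=\frac p{p-1}$, the operator $M^+$ is bounded on $L^{p,q}(w)$, and its norm (the least $K$ with $\|M^+f\|_{L^{p,q}(w)}\le K\|f\|_{L^{p,q}(w)}$ for all $f\in L^{p,q}(w)$) satisfies $$\|M^+\|_{L^{p,q}(w)\to L^{p,q}(w)}\le\begin{cases}C\,[\sigma]_{A_\infty^-}^{1/p}\,[w]_{A_p^+}^{1/p} & \text{if } p\le q\le\infty,\\ C\,[\sigma]_{A_\infty^-}^{1/q}\,[w]_{A_p^+}^{1/p} & \text{if } 0<q\le p.\end{cases}$$ -/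

import Mathlib

open MeasureTheory Set
open scoped ENNReal NNReal

noncomputable section

namespace OneSided

/-- The one-sided maximal function `M⁺f(x) = sup_{h>0} (1/h) ∫_x^{x+h} |f|`. -/
def maximalPlus {E : Type*} [ENorm E] (f : ℝ → E) (x : ℝ) : ℝ≥0∞ :=
  ⨆ (h : ℝ) (_ : 0 < h), (∫⁻ y in Ioo x (x + h), ‖f y‖ₑ) / ENNReal.ofReal h

/-- `[w]_{A_p⁺}`, the supremum over `a < b < c` of
`(1/(c-a)) ∫_a^b w * ((1/(c-a)) ∫_b^c w^{-1/(p-1)})^{p-1}`,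
with `0^{-1/(p-1)} = ∞` and `0 * ∞ = 0`. -/
def apPlusConst (p : ℝ) (w : ℝ → ℝ≥0∞) : ℝ≥0∞ :=
  ⨆ (a : ℝ) (b : ℝ) (c : ℝ) (_ : a < b) (_ : b < c),
    ((∫⁻ x in Ioo a b, w x) / ENNReal.ofReal (c - a)) *
      ((∫⁻ x in Ioo b c, w x ^ (-1 / (p - 1))) / ENNReal.ofReal (c - a)) ^ (p - 1)

/-- `[w]_{A_∞⁻}`, the supremum over bounded intervals `I` of `(1/w(I)) ∫_I M⁺(χ_I w)`.
An interval with `w(I) = 0` or `w(I) = ∞` contributes `0`; equivalently, the constant is the least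
`K` with `∫_I M⁺(χ_I w) ≤ K w(I)` for all intervals with `0 < w(I) < ∞`. -/
def aInftyMinusConst (w : ℝ → ℝ≥0∞) : ℝ≥0∞ :=
  ⨆ (a : ℝ) (b : ℝ) (_ : a < b),
    (∫⁻ x in Ioo a b, maximalPlus ((Ioo a b).indicator w) x) / ∫⁻ x in Ioo a b, w x

/-- The dual weight `σ = w^{1-p'}`, where `p' = p/(p-1)`. -/
def dualWeight (p : ℝ) (w : ℝ → ℝ≥0∞) (x : ℝ) : ℝ≥0∞ :=
  w x ^ (1 - Real.conjExponent p)

/-- The Lorentz quasi-norm through the distribution function `μ {|f| > t}`: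
`(p ∫_0^∞ (t μ{|f| > t}^{1/p})^q dt/t)^{1/q}` for `q < ∞`, and
`sup_{t>0} t μ{|f| > t}^{1/p}` for `q = ∞`. -/
def lorentzNorm {Ω E : Type*} [MeasurableSpace Ω] [ENorm E]
    (p : ℝ) (q : ℝ≥0∞) (μ : Measure Ω) (f : Ω → E) : ℝ≥0∞ :=
  if q = ∞ then
    ⨆ (t : ℝ) (_ : 0 < t), ENNReal.ofReal t * μ {x | ENNReal.ofReal t < ‖f x‖ₑ} ^ (1 / p)
  else
    (ENNReal.ofReal p * ∫⁻ t in Ioi (0 : ℝ),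
      (ENNReal.ofReal t * μ {x | ENNReal.ofReal t < ‖f x‖ₑ} ^ (1 / p)) ^ q.toReal
        / ENNReal.ofReal t) ^ (1 / q.toReal)

/-- Membership in the Lorentz space `L^{p,q}(μ)`. -/
def MemLorentz {Ω E : Type*} [MeasurableSpace Ω] [TopologicalSpace E] [ENorm E]
    (p : ℝ) (q : ℝ≥0∞) (μ : Measure Ω) (f : Ω → E) : Prop :=
  AEStronglyMeasurable f μ ∧ lorentzNorm p q μ f < ∞

/-- `‖M⁺‖_{L^{p,q}(w) → L^{p,q}(w)}`, the least `K ∈ [0,∞]` with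
`‖M⁺f‖_{L^{p,q}(w)} ≤ K ‖f‖_{L^{p,q}(w)}` for every `f ∈ L^{p,q}(w)`. -/
def maximalPlusNorm (p : ℝ) (q : ℝ≥0∞) (w : ℝ → ℝ≥0∞) : ℝ≥0∞ :=
  sInf {K : ℝ≥0∞ | ∀ f : ℝ → ℂ, MemLorentz p q (volume.withDensity w) f →
    lorentzNorm p q (volume.withDensity w) (maximalPlus f) ≤
      K * lorentzNorm p q (volume.withDensity w) f}

/-- A weight `w ≥ 0`, regarded as an `[0,∞]`-valued function. -/
def toWeight (w : ℝ → ℝ) (x : ℝ) : ℝ≥0∞ := ENNReal.ofReal (w x)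

end OneSided

end

namespace OneSided

open Filter Topology

/-! The bound is obtained by interpolating between the trivial `L^∞` estimate and a weak type `(r,
r)` estimate with `r` slightly below `p`. Truncating `f` at height `t / 2` and slicing it dyadically
gives `w{M⁺f > t} ≤ B ∑ₖ 2^{kr} w{|f| > 2^{k-1} t}` with `B` a multiple of `[w]_{A_r⁺}`
(`weight_lt_maximalPlus_le_tsum`). Taking the Lorentz functional produces a geometric series of
ratio `2^{-(p-r)}` or `2^{-(p-r)q/p}`, whose sum is of order `1 / (p - r)`. For `q ≤ p` the sum
comes out with power `1/q`, by subadditivity of `x ↦ x^{q/p}`; for `q ≥ p` with power `1/p`, by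
convexity.

It remains to have `p - r` comparable to `1 / [σ]_{A_∞⁻}` with `[w]_{A_r⁺}` still bounded by a
multiple of `[w]_{A_p⁺}` (`apPlusConst_self_improve`). The source is a weak reverse Hölder
inequality: if `δ [σ]_{A_∞⁻} ≤ 1/2`, the integral of `σ^{1+δ}` over `(a, c)` is at most `2
M⁺(χσ)(a)^{1+δ} (c - a)` (`setLIntegral_rpow_le_maximalPlus`). Applied on `(x, c)` for every `x` in
`(a, b)`, it places `(a, b)` inside a level set of `M⁺(χσ)`, and the `w`-measure of such a set is
controlled by `A_p⁺`. The admissible exponent is `r = 1 + (p - 1) / (1 + δ)`.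

Estimates on level sets rest on the rising sun lemma. Since `A_p⁺` compares `w` on an interval with
`σ` on the next one, each component is cut at points halving the remaining mass of `g`: two
consecutive pieces then see enough mass in the next piece (`measure_levelSet_le`).

As `w` may vanish, `σ` may be infinite; however `σ` is locally integrable to the right of any point
having `w`-mass on its left, and the complementary half-line is `w`-null. -/

/-! ### The rising sun lemma -/

/-- The points of `(a, c)` from which a larger value of `F` is visible in `(x, c]`. -/
def risingSun (F : ℝ → ℝ) (a c : ℝ) : Set ℝ :=
  {x | x ∈ Ioo a c ∧ ∃ y ∈ Ioc x c, F x < F y}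

theorem risingSun_subset (F : ℝ → ℝ) (a c : ℝ) : risingSun F a c ⊆ Ioo a c := fun _ hx => hx.1

theorem isOpen_risingSun {F : ℝ → ℝ} {a c : ℝ} (hF : ContinuousOn F (Icc a c)) :
    IsOpen (risingSun F a c) := by
  rw [isOpen_iff_mem_nhds]
  rintro x ⟨hx, y, hy, hxy⟩
  have h1 : ContinuousAt F x := hF.continuousAt (Icc_mem_nhds hx.1 hx.2)
  filter_upwards [h1.eventually (gt_mem_nhds hxy), Ioo_mem_nhds hx.1 hy.1] with z hz hz'
  exact ⟨⟨hz'.1, hz'.2.trans_le hy.2⟩, y, ⟨hz'.2, hy.2⟩, hz⟩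

/-- The endpoints are the infimum and supremum of the component. An endpoint lying in `O` would join
the component, which is open and would then extend beyond it. -/
theorem ordConnectedComponent_eq_Ioo {O : Set ℝ} (hO : IsOpen O) {a c x : ℝ}
    (hsub : O ⊆ Ioo a c) (hx : x ∈ O) :
    ∃ α β, a ≤ α ∧ α < β ∧ β ≤ c ∧ α ∉ O ∧ β ∉ O ∧ ordConnectedComponent O x = Ioo α β := by
  set C := ordConnectedComponent O x with hC
  have hxC : x ∈ C := self_mem_ordConnectedComponent.2 hx
  have hCO : C ⊆ O := ordConnectedComponent_subset
  have hCbb : BddBelow C := ⟨a, fun z hz => (hsub (hCO hz)).1.le⟩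
  have hCba : BddAbove C := ⟨c, fun z hz => (hsub (hCO hz)).2.le⟩
  have hCopen : ∀ z ∈ C, C ∈ 𝓝 z := by
    intro z hz
    have h : C = ordConnectedComponent O z :=
      ordConnectedComponent_eq (mem_ordConnectedComponent.1 hz)
    rw [h]
    exact ordConnectedComponent_mem_nhds.2 (hO.mem_nhds (hCO hz))
  have hIoo : Ioo (sInf C) (sSup C) ⊆ C := by
    intro z hz
    obtain ⟨u, hu, huz⟩ := exists_lt_of_csInf_lt ⟨x, hxC⟩ hz.1
    obtain ⟨v, hv, hvz⟩ := exists_lt_of_lt_csSup ⟨x, hxC⟩ hz.2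
    have : OrdConnected C := inferInstanceAs (OrdConnected (ordConnectedComponent O x))
    exact this.out hu hv ⟨huz.le, hvz.le⟩
  have hinfC : sInf C ∉ C := by
    intro h
    obtain ⟨l, hl, hl'⟩ := exists_Ioc_subset_of_mem_nhds (hCopen _ h) ⟨sInf C - 1, by linarith⟩
    have : (l + sInf C) / 2 ∈ C := hl' ⟨by linarith, by linarith⟩
    linarith [csInf_le hCbb this]
  have hsupC : sSup C ∉ C := by
    intro h
    obtain ⟨l, hl, hl'⟩ := exists_Ico_subset_of_mem_nhds (hCopen _ h) ⟨sSup C + 1, by linarith⟩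
    have : (l + sSup C) / 2 ∈ C := hl' ⟨by linarith, by linarith⟩
    linarith [le_csSup hCba this]
  have hsubC : C ⊆ Ioo (sInf C) (sSup C) := fun z hz =>
    ⟨lt_of_le_of_ne (csInf_le hCbb hz) (fun h => hinfC (h ▸ hz)),
      lt_of_le_of_ne (le_csSup hCba hz) (fun h => hsupC (h ▸ hz))⟩
  have hxI := hsubC hxC
  refine ⟨sInf C, sSup C, le_csInf ⟨x, hxC⟩ fun z hz => (hsub (hCO hz)).1.le, hxI.1.trans hxI.2,
    csSup_le ⟨x, hxC⟩ fun z hz => (hsub (hCO hz)).2.le, ?_, ?_, Subset.antisymm hsubC hIoo⟩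
  · intro h
    apply hinfC
    rw [hC, mem_ordConnectedComponent, uIcc_of_ge hxI.1.le]
    intro z hz
    rcases eq_or_lt_of_le hz.1 with h1 | h1
    · exact h1 ▸ h
    · exact hCO (hIoo ⟨h1, hz.2.trans_lt hxI.2⟩)
  · intro h
    apply hsupC
    rw [hC, mem_ordConnectedComponent, uIcc_of_le hxI.2.le]
    intro z hz
    rcases eq_or_lt_of_le hz.2 with h1 | h1
    · exact h1 ▸ h
    · exact hCO (hIoo ⟨hxI.1.trans_le hz.1, h1⟩)

/-- The components are disjoint nonempty open sets, hence countably many, and the inequality can be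
summed over them. -/
theorem measure_le_of_ordConnectedComponent {O : Set ℝ} (hO : IsOpen O) {μ ν : Measure ℝ}
    (h : ∀ x ∈ O, μ (ordConnectedComponent O x) ≤ ν (ordConnectedComponent O x)) :
    μ O ≤ ν O := by
  set 𝒞 : Set (Set ℝ) := (fun x => ordConnectedComponent O x) '' O with h𝒞
  have hopen : ∀ s ∈ 𝒞, IsOpen s := by
    rintro _ ⟨x, hx, rfl⟩
    rw [isOpen_iff_mem_nhds]
    intro z hz
    have h : ordConnectedComponent O x = ordConnectedComponent O z :=
      ordConnectedComponent_eq (mem_ordConnectedComponent.1 hz)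
    simp only [h]
    exact ordConnectedComponent_mem_nhds.2 (hO.mem_nhds (ordConnectedComponent_subset hz))
  have hdisj : 𝒞.PairwiseDisjoint id := by
    rintro _ ⟨x, hx, rfl⟩ _ ⟨y, hy, rfl⟩ hne
    refine Set.disjoint_left.2 fun z hz hz' => hne ?_
    exact (ordConnectedComponent_eq (mem_ordConnectedComponent.1 hz)).trans
      (ordConnectedComponent_eq (mem_ordConnectedComponent.1 hz')).symm
  have hcount : 𝒞.Countable := hdisj.countable_of_isOpen hopen (by
    rintro _ ⟨x, hx, rfl⟩
    exact nonempty_ordConnectedComponent.2 hx)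
  have hun : ⋃₀ 𝒞 = O := by
    apply Subset.antisymm
    · rintro z ⟨_, ⟨x, hx, rfl⟩, hz⟩
      exact ordConnectedComponent_subset hz
    · intro x hx
      exact ⟨_, ⟨x, hx, rfl⟩, self_mem_ordConnectedComponent.2 hx⟩
  rw [← hun, measure_sUnion hcount hdisj fun s hs => (hopen s hs).measurableSet,
    measure_sUnion hcount hdisj fun s hs => (hopen s hs).measurableSet]
  refine ENNReal.tsum_le_tsum ?_
  rintro ⟨_, x, hx, rfl⟩
  exact h x hx

/-- Both properties of a component come from its endpoints lying outside the set. Nothing to the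
right of `β` exceeds `F β`, and the maximum of `F` over `[z, c]` is never attained inside the
component. At `α` the same reasoning gives `F β ≤ F α`, except when `α = a`, a point excluded by
definition. -/
theorem measure_risingSun_le {F : ℝ → ℝ} {a c : ℝ} (hF : ContinuousOn F (Icc a c))
    {μ ν : Measure ℝ}
    (h : ∀ α β, a ≤ α → α < β → β ≤ c → Ioo α β ⊆ risingSun F a c →
      (∀ x ∈ Ioc α c, F x ≤ F β) → (α = a ∨ F β ≤ F α) → μ (Ioo α β) ≤ ν (Ioo α β)) :
    μ (risingSun F a c) ≤ ν (risingSun F a c) := by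
  refine measure_le_of_ordConnectedComponent (isOpen_risingSun hF) fun x hx => ?_
  obtain ⟨α, β, haα, hαβ, hβc, hα, hβ, hC⟩ :=
    ordConnectedComponent_eq_Ioo (isOpen_risingSun hF) (risingSun_subset F a c) hx
  have hsub : Ioo α β ⊆ risingSun F a c := hC ▸ ordConnectedComponent_subset
  have hβmax : ∀ y ∈ Icc β c, F y ≤ F β := by
    intro y hy
    rcases eq_or_lt_of_le hy.1 with h1 | h1
    · rw [h1]
    · by_contra hlt
      exact hβ ⟨⟨by linarith, h1.trans_le hy.2⟩, y, ⟨h1, hy.2⟩, not_le.1 hlt⟩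
  rw [hC]
  refine h α β haα hαβ hβc hsub ?_ ?_
  · intro z hz
    obtain ⟨m, hm, hmax⟩ := isCompact_Icc.exists_isMaxOn (nonempty_Icc.2 hz.2)
      (hF.mono (Icc_subset_Icc_left (haα.trans hz.1.le)))
    rcases lt_or_ge m β with hmβ | hmβ
    · obtain ⟨-, y, hy, hlt⟩ := hsub ⟨hz.1.trans_le hm.1, hmβ⟩
      exact absurd (hmax ⟨hm.1.trans hy.1.le, hy.2⟩) (not_le.2 hlt)
    · exact (hmax ⟨le_rfl, hz.2⟩).trans (hβmax m ⟨hmβ, hm.2⟩)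
  · rcases eq_or_lt_of_le haα with h1 | h1
    · exact Or.inl h1.symm
    · refine Or.inr ?_
      by_contra hlt
      exact hα ⟨⟨h1, hαβ.trans_le hβc⟩, β, ⟨hαβ, hβc⟩, not_le.1 hlt⟩

/-! ### Integrals over intervals -/

theorem setLIntegral_Ioo_add (g : ℝ → ℝ≥0∞) {a b c : ℝ} (hab : a ≤ b) (hbc : b ≤ c) :
    ∫⁻ y in Ioo a c, g y = (∫⁻ y in Ioo a b, g y) + ∫⁻ y in Ioo b c, g y := by
  simp only [setLIntegral_congr (Ioo_ae_eq_Ioc (μ := (volume : Measure ℝ)))]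
  rw [← Ioc_union_Ioc_eq_Ioc hab hbc, lintegral_union measurableSet_Ioc
    (Ioc_disjoint_Ioc_of_le le_rfl)]

theorem continuousOn_toReal_setLIntegral {g : ℝ → ℝ≥0∞} (hg : AEMeasurable g volume) {a b : ℝ}
    (hfin : ∫⁻ y in Ioo a b, g y ≠ ∞) :
    ContinuousOn (fun x => (∫⁻ y in Ioo a x, g y).toReal) (Icc a b) := by
  have hfin' : ∫⁻ y in Icc a b, g y ≠ ∞ := by
    rwa [← setLIntegral_congr (Ioo_ae_eq_Icc (μ := (volume : Measure ℝ)))]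
  have hint : IntegrableOn (fun y => (g y).toReal) (Icc a b) :=
    integrable_toReal_of_lintegral_ne_top hg.restrict hfin'
  refine (intervalIntegral.continuousOn_primitive hint).congr fun x hx => ?_
  simp only
  rw [setLIntegral_congr (Ioo_ae_eq_Ioc (μ := (volume : Measure ℝ))), integral_toReal hg.restrict]
  refine ae_lt_top' hg.restrict (ne_top_of_le_ne_top hfin' (lintegral_mono_set ?_))
  exact fun y hy => ⟨hy.1.le, hy.2.trans hx.2⟩

/-- A geometric sequence of points exhausting `(a, b)` along which the mass of `g` to the right is
halved at each step. -/
theorem exists_halving_seq {g : ℝ → ℝ≥0∞} (hg : AEMeasurable g volume) {a b : ℝ} (hab : a < b)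
    (hfin : ∫⁻ y in Ioo a b, g y ≠ ∞) (hpos : ∀ x ∈ Ico a b, ∫⁻ y in Ioo x b, g y ≠ 0) :
    ∃ x : ℕ → ℝ, x 0 = a ∧ StrictMono x ∧ (∀ n, x n < b) ∧ Tendsto x atTop (𝓝 b) ∧
      ∀ n, ∫⁻ y in Ioo (x n) b, g y = 2 * ∫⁻ y in Ioo (x (n + 1)) b, g y := by
  have hfx : ∀ x ∈ Ico a b, ∫⁻ y in Ioo x b, g y ≠ ∞ := fun x hx =>
    ne_top_of_le_ne_top hfin (lintegral_mono_set (Ioo_subset_Ioo_left hx.1))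
  have step : ∀ x : Ico a b, ∃ y : Ico a b, x.1 < y.1 ∧
      ∫⁻ z in Ioo x.1 b, g z = 2 * ∫⁻ z in Ioo y.1 b, g z := by
    rintro ⟨x, hx⟩
    set H := ∫⁻ z in Ioo x b, g z with hH
    have hH0 : 0 < H.toReal := ENNReal.toReal_pos (hpos x hx) (hfx x hx)
    have hcont := continuousOn_toReal_setLIntegral hg (hfx x hx)
    have hmem : H.toReal / 2 ∈ Icc ((fun y => (∫⁻ z in Ioo x y, g z).toReal) x)
        ((fun y => (∫⁻ z in Ioo x y, g z).toReal) b) := by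
      simp only [Ioo_self, Measure.restrict_empty, lintegral_zero_measure, ENNReal.toReal_zero]
      rw [← hH]
      constructor <;> linarith
    obtain ⟨y, hy, hyH⟩ := intermediate_value_Icc hx.2.le hcont hmem
    have hsplit := setLIntegral_Ioo_add g hy.1 hy.2
    have hxy : x < y := by
      refine lt_of_le_of_ne hy.1 ?_
      rintro rfl
      simp at hyH
      linarith
    have hyb : y < b := by
      refine lt_of_le_of_ne hy.2 ?_
      rintro rfl
      simp only [← hH] at hyH
      linarith
    have hyI : y ∈ Ico a b := ⟨hx.1.trans hxy.le, hyb⟩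
    refine ⟨⟨y, hyI⟩, hxy, ?_⟩
    have hxyfin : ∫⁻ z in Ioo x y, g z ≠ ∞ :=
      ne_top_of_le_ne_top (hfx x hx) (lintegral_mono_set (Ioo_subset_Ioo_right hyb.le))
    have h2 := congrArg ENNReal.toReal hsplit
    rw [ENNReal.toReal_add hxyfin (hfx y hyI)] at h2
    simp only at hyH
    rw [← ENNReal.toReal_eq_toReal_iff' (hfx x hx)
      (ENNReal.mul_ne_top ENNReal.ofNat_ne_top (hfx y hyI)), ENNReal.toReal_mul,
      ENNReal.toReal_ofNat]
    rw [hyH, ← hH] at h2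
    rw [← hH]
    linarith
  choose s hs1 hs2 using step
  let X : ℕ → Ico a b := fun n => s^[n] ⟨a, le_rfl, hab⟩
  have hX : ∀ n, X (n + 1) = s (X n) := fun n => Function.iterate_succ_apply' s n _
  have hmono : StrictMono fun n => (X n).1 :=
    strictMono_nat_of_lt_succ fun n => by rw [hX]; exact hs1 _
  have hhalf : ∀ n, ∫⁻ y in Ioo (X n).1 b, g y = 2 * ∫⁻ y in Ioo (X (n + 1)).1 b, g y :=
    fun n => by rw [hX]; exact hs2 _
  refine ⟨fun n => (X n).1, rfl, hmono, fun n => (X n).2.2, ?_, hhalf⟩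
  have hbdd : BddAbove (range fun n => (X n).1) := by
    refine ⟨b, ?_⟩
    rintro _ ⟨n, rfl⟩
    exact (X n).2.2.le
  have hlim := tendsto_atTop_ciSup hmono.monotone hbdd
  set L := ⨆ n, (X n).1 with hL
  have hLb : L ≤ b := ciSup_le fun n => (X n).2.2.le
  rcases eq_or_lt_of_le hLb with h | h
  · rwa [h] at hlim
  · exfalso
    have hLI : L ∈ Ico a b := ⟨le_ciSup hbdd 0, h⟩
    -- If the points stopped at `L < b`, the positive mass beyond `L` would survive every halving,
    -- against the finiteness of the total mass.
    have hle : ∀ n, (2 : ℝ≥0∞) ^ n * ∫⁻ y in Ioo L b, g y ≤ ∫⁻ y in Ioo a b, g y := by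
      intro n
      have : ∀ n, ∫⁻ y in Ioo a b, g y = 2 ^ n * ∫⁻ y in Ioo (X n).1 b, g y := by
        intro n
        induction n with
        | zero => simp [X]
        | succ n ih => rw [ih, hhalf, pow_succ, mul_assoc]
      rw [this n]
      gcongr
      exact le_ciSup hbdd n
    have h0 := hpos L hLI
    have htend : Tendsto (fun n : ℕ => (2 : ℝ≥0∞) ^ n * ∫⁻ y in Ioo L b, g y) atTop (𝓝 ∞) := by
      have h1 : Tendsto (fun n : ℕ => (2 : ℝ≥0∞) ^ n) atTop (𝓝 ∞) :=
        ENNReal.tendsto_pow_atTop_nhds_top_iff.2 (by norm_num)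
      have := ENNReal.Tendsto.mul_const (b := ∫⁻ y in Ioo L b, g y) h1 (Or.inl (by simp))
      rwa [ENNReal.top_mul h0] at this
    exact hfin (top_le_iff.1 (le_of_tendsto' htend hle))

/-- The factor `2` is the overlap of the intervals `(x n, x (n + 2))`. -/
theorem measure_Ioo_le_two_mul_of_seq {μ ν : Measure ℝ} [NullSingletonClass μ] [NullSingletonClass ν] {a b : ℝ}
    {x : ℕ → ℝ} (hx0 : x 0 = a) (hmono : StrictMono x) (hxb : ∀ n, x n < b)
    (hlim : Tendsto x atTop (𝓝 b))
    (h : ∀ n, μ (Ioo (x n) (x (n + 1))) ≤ ν (Ioo (x n) (x (n + 2)))) :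
    μ (Ioo a b) ≤ 2 * ν (Ioo a b) := by
  have hcover : Ioo a b ⊆ ⋃ n, Ico (x n) (x (n + 1)) := by
    intro z hz
    have hex : ∃ n, z < x n := (hlim.eventually (lt_mem_nhds hz.2)).exists
    classical
    have hk := Nat.find_spec hex
    rcases Nat.eq_zero_or_pos (Nat.find hex) with h0 | h0
    · rw [h0, hx0] at hk
      exact absurd hk (not_lt.2 hz.1.le)
    · obtain ⟨m, hm⟩ := Nat.exists_eq_succ_of_ne_zero h0.ne'
      have hm' := Nat.find_min hex (m := m) (by omega)
      rw [hm] at hk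
      exact mem_iUnion.2 ⟨m, not_lt.1 hm', hk⟩
  have hsum : ∑' n, ν (Ioo (x n) (x (n + 1))) ≤ ν (Ioo a b) := by
    rw [← measure_iUnion]
    · refine measure_mono (iUnion_subset fun n => Ioo_subset_Ioo ?_ (hxb _).le)
      rw [← hx0]
      exact hmono.monotone (Nat.zero_le n)
    · exact pairwise_disjoint_mono hmono.monotone.pairwise_disjoint_on_Ioo_succ fun n => le_rfl
    · exact fun n => measurableSet_Ioo
  have hsplit : ∀ n, ν (Ioo (x n) (x (n + 2))) ≤
      ν (Ioo (x n) (x (n + 1))) + ν (Ioo (x (n + 1)) (x (n + 2))) := by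
    intro n
    rw [measure_congr (Ioo_ae_eq_Ioc (μ := ν) (a := x n) (b := x (n + 1)))]
    refine (measure_mono ?_).trans (measure_union_le _ _)
    intro z hz
    rcases le_or_gt z (x (n + 1)) with h1 | h1
    · exact Or.inl ⟨hz.1, h1⟩
    · exact Or.inr ⟨h1, hz.2⟩
  calc μ (Ioo a b) ≤ ∑' n, μ (Ico (x n) (x (n + 1))) :=
        (measure_mono hcover).trans (measure_iUnion_le _)
    _ = ∑' n, μ (Ioo (x n) (x (n + 1))) := by
        simp only [measure_congr (Ioo_ae_eq_Ico (μ := μ))]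
    _ ≤ ∑' n, (ν (Ioo (x n) (x (n + 1))) + ν (Ioo (x (n + 1)) (x (n + 2)))) :=
        ENNReal.tsum_le_tsum fun n => (h n).trans (hsplit n)
    _ = ∑' n, ν (Ioo (x n) (x (n + 1))) + ∑' n, ν (Ioo (x (n + 1)) (x (n + 2))) :=
        ENNReal.tsum_add
    _ ≤ ν (Ioo a b) + ν (Ioo a b) := by
        gcongr
        exact (ENNReal.tsum_comp_le_tsum_of_injective (add_left_injective 1)
          fun n => ν (Ioo (x n) (x (n + 1)))).trans hsum
    _ = 2 * ν (Ioo a b) := (two_mul _).symm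

/-- The interval from `x (n + 1)` to `x (n + 2)` carries exactly a quarter of the mass of `g` on `(x
n, b)`, which is at least `t (b - x n)`. This is the origin of the constant `4`. -/
theorem measure_Ioo_le_of_halving {g : ℝ → ℝ≥0∞} (hg : AEMeasurable g volume) {a b t : ℝ}
    (hab : a < b) (ht : 0 < t) (hfin : ∫⁻ y in Ioo a b, g y ≠ ∞)
    (hlow : ∀ x ∈ Ioo a b, ENNReal.ofReal (t * (b - x)) ≤ ∫⁻ y in Ioo x b, g y)
    {μ ν : Measure ℝ} [NullSingletonClass μ] [NullSingletonClass ν]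
    (h : ∀ x y z, a ≤ x → x < y → y < z → z ≤ b →
      ENNReal.ofReal (t * (z - x)) ≤ 4 * ∫⁻ s in Ioo y z, g s → μ (Ioo x y) ≤ ν (Ioo x z)) :
    μ (Ioo a b) ≤ 2 * ν (Ioo a b) := by
  have hlow' : ∀ x ∈ Ico a b, ENNReal.ofReal (t * (b - x)) ≤ ∫⁻ y in Ioo x b, g y := by
    intro x hx
    rcases eq_or_lt_of_le hx.1 with h1 | h1
    · subst h1
      -- The first point of the sequence is `a` itself, where the lower bound is reached by letting
      -- `s` decrease to `a`.
      have hc : Tendsto (fun s => ENNReal.ofReal (t * (b - s))) (𝓝[>] a)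
          (𝓝 (ENNReal.ofReal (t * (b - a)))) :=
        ((ENNReal.continuous_ofReal.comp (by fun_prop)).tendsto a).mono_left nhdsWithin_le_nhds
      refine le_of_tendsto hc ?_
      filter_upwards [Ioo_mem_nhdsGT hab] with s hs
      exact (hlow s hs).trans (lintegral_mono_set (Ioo_subset_Ioo_left hs.1.le))
    · exact hlow x ⟨h1, hx.2⟩
  obtain ⟨x, hx0, hmono, hxb, hlim, hhalf⟩ := exists_halving_seq hg hab hfin (by
    intro x hx h0
    have := hlow' x hx
    rw [h0, nonpos_iff_eq_zero, ENNReal.ofReal_eq_zero] at this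
    nlinarith [hx.2])
  refine measure_Ioo_le_two_mul_of_seq hx0 hmono hxb hlim fun n => ?_
  have han : ∀ n, a ≤ x n := fun n => hx0 ▸ hmono.monotone (Nat.zero_le n)
  refine h _ _ _ (han n) (hmono (by omega)) (hmono (by omega)) (hxb _).le ?_
  have h1 := setLIntegral_Ioo_add g (hmono (show n + 1 < n + 2 by omega)).le (hxb (n + 2)).le
  have h2 := hhalf (n + 1)
  have hfin2 : ∫⁻ y in Ioo (x (n + 2)) b, g y ≠ ∞ :=
    ne_top_of_le_ne_top hfin (lintegral_mono_set (Ioo_subset_Ioo_left (han _)))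
  have h3 : ∫⁻ y in Ioo (x (n + 1)) (x (n + 2)), g y = ∫⁻ y in Ioo (x (n + 2)) b, g y := by
    rw [h2, two_mul] at h1
    exact ((ENNReal.add_left_inj hfin2).1 h1).symm
  calc ENNReal.ofReal (t * (x (n + 2) - x n)) ≤ ENNReal.ofReal (t * (b - x n)) := by
        gcongr
        exact (hxb _).le
    _ ≤ ∫⁻ y in Ioo (x n) b, g y := hlow' _ ⟨han n, hxb n⟩
    _ = 4 * ∫⁻ y in Ioo (x (n + 1)) (x (n + 2)), g y := by
        rw [hhalf, h2, h3, ← mul_assoc]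
        norm_num

/-! ### Level sets of the one-sided maximal function -/

theorem exists_lt_setLIntegral_Ioo (g : ℝ → ℝ≥0∞) {x y : ℝ} {K : ℝ≥0∞}
    (h : K < ∫⁻ z in Ioo x y, g z) : ∃ x' ∈ Ioo x y, K < ∫⁻ z in Ioo x' y, g z := by
  rcases le_or_gt y x with hyx | hxy
  · simp [Ioo_eq_empty_of_le hyx] at h
  obtain ⟨u, hu, hux, hulim⟩ := exists_seq_strictAnti_tendsto' hxy
  have hU : Ioo x y = ⋃ n, Ioo (u n) y := by
    apply Subset.antisymm
    · intro z hz
      obtain ⟨n, hn⟩ := (hulim.eventually (gt_mem_nhds hz.1)).exists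
      exact mem_iUnion.2 ⟨n, hn, hz.2⟩
    · exact iUnion_subset fun n => Ioo_subset_Ioo_left (hux n).1.le
  rw [hU, setLIntegral_iUnion_of_directed _
    (Monotone.directed_le fun m n hmn => Ioo_subset_Ioo_left (hu.antitone hmn)),
    lt_iSup_iff] at h
  obtain ⟨n, hn⟩ := h
  exact ⟨u n, hux n, hn⟩

theorem maximalPlus_enorm {E : Type*} [SeminormedAddGroup E] (f : ℝ → E) :
    maximalPlus (fun y => ‖f y‖ₑ) = maximalPlus f := by
  ext x
  simp only [maximalPlus, enorm_eq_self]

theorem lt_maximalPlus_iff {g : ℝ → ℝ≥0∞} {t x : ℝ} (ht : 0 ≤ t) :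
    ENNReal.ofReal t < maximalPlus g x ↔
      ∃ y, x < y ∧ ENNReal.ofReal (t * (y - x)) < ∫⁻ z in Ioo x y, g z := by
  have key : ∀ h : ℝ, 0 < h → (ENNReal.ofReal t < (∫⁻ y in Ioo x (x + h), g y) / ENNReal.ofReal h ↔
      ENNReal.ofReal (t * h) < ∫⁻ y in Ioo x (x + h), g y) := by
    intro h hh
    rw [ENNReal.lt_div_iff_mul_lt (Or.inl (by simpa using hh)) (Or.inl ENNReal.ofReal_ne_top),
      ENNReal.ofReal_mul ht]
  simp only [maximalPlus, lt_iSup_iff, enorm_eq_self]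
  constructor
  · rintro ⟨h, hh, hlt⟩
    refine ⟨x + h, by linarith, ?_⟩
    rw [add_sub_cancel_left]
    exact (key h hh).1 hlt
  · rintro ⟨y, hy, hlt⟩
    refine ⟨y - x, sub_pos.2 hy, (key _ (sub_pos.2 hy)).2 ?_⟩
    rwa [add_sub_cancel]

theorem measurable_maximalPlus (g : ℝ → ℝ≥0∞) : Measurable (maximalPlus g) := by
  refine measurable_of_Ioi fun s => ?_
  rcases eq_or_ne s ∞ with rfl | hs
  · simp
  refine IsOpen.measurableSet (isOpen_iff_mem_nhds.2 fun x hx => ?_)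
  rw [← ENNReal.ofReal_toReal hs] at hx ⊢
  obtain ⟨y, hy, hlt⟩ := (lt_maximalPlus_iff ENNReal.toReal_nonneg).1 hx
  obtain ⟨x', hx', hlt'⟩ := exists_lt_setLIntegral_Ioo g hlt
  have hc : ContinuousAt (fun z => ENNReal.ofReal (s.toReal * (y - z))) x :=
    (ENNReal.continuous_ofReal.comp (by fun_prop)).continuousAt
  filter_upwards [hc.eventually (gt_mem_nhds hlt'), gt_mem_nhds hx'.1] with z hz hz'
  refine (lt_maximalPlus_iff ENNReal.toReal_nonneg).2 ⟨y, hz'.trans hx'.2, hz.trans_le ?_⟩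
  exact lintegral_mono_set (Ioo_subset_Ioo_left hz'.le)

/-- The set of `x ∈ (a, c)` where the one-sided maximal function of `g`, localized to `(a, c)`,
exceeds `t`. -/
def levelSet (g : ℝ → ℝ≥0∞) (t a c : ℝ) : Set ℝ :=
  {x | x ∈ Ioo a c ∧ ∃ y ∈ Ioc x c, ENNReal.ofReal (t * (y - x)) < ∫⁻ z in Ioo x y, g z}

theorem levelSet_subset (g : ℝ → ℝ≥0∞) (t a c : ℝ) : levelSet g t a c ⊆ Ioo a c :=
  fun _ hx => hx.1

theorem mem_levelSet_iff {g : ℝ → ℝ≥0∞} {t a c x : ℝ} (ht : 0 ≤ t) (hx : x ∈ Ico a c) :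
    (∃ y ∈ Ioc x c, ENNReal.ofReal (t * (y - x)) < ∫⁻ z in Ioo x y, g z) ↔
      ENNReal.ofReal t < maximalPlus ((Ioo a c).indicator g) x := by
  rw [lt_maximalPlus_iff ht]
  have hset : ∀ y, ∫⁻ z in Ioo x y, (Ioo a c).indicator g z = ∫⁻ z in Ioo x (min y c), g z := by
    intro y
    rw [setLIntegral_indicator measurableSet_Ioo]
    congr 2
    ext z
    simp only [mem_inter_iff, mem_Ioo, lt_min_iff]
    constructor
    · rintro ⟨⟨_, h2⟩, h3, h4⟩
      exact ⟨h3, h4, h2⟩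
    · rintro ⟨h3, h4, h2⟩
      exact ⟨⟨hx.1.trans_lt h3, h2⟩, h3, h4⟩
  simp only [hset]
  constructor
  · rintro ⟨y, hy, h⟩
    exact ⟨y, hy.1, by rwa [min_eq_left hy.2]⟩
  · rintro ⟨y, hy, h⟩
    refine ⟨min y c, ⟨lt_min hy hx.2, min_le_right _ _⟩, lt_of_le_of_lt ?_ h⟩
    gcongr
    exact min_le_left _ _

theorem levelSet_eq (g : ℝ → ℝ≥0∞) {t a c : ℝ} (ht : 0 ≤ t) :
    levelSet g t a c =
      {x | x ∈ Ioo a c ∧ ENNReal.ofReal t < maximalPlus ((Ioo a c).indicator g) x} := by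
  ext x
  exact and_congr_right fun hx => mem_levelSet_iff ht ⟨hx.1.le, hx.2⟩

theorem measurableSet_levelSet (g : ℝ → ℝ≥0∞) {t a c : ℝ} (ht : 0 ≤ t) :
    MeasurableSet (levelSet g t a c) := by
  rw [levelSet_eq g ht]
  exact measurableSet_Ioo.inter (measurableSet_lt measurable_const (measurable_maximalPlus _))

/-- The function whose rising sun set is `levelSet g t a c`. -/
noncomputable def tilted (g : ℝ → ℝ≥0∞) (t a x : ℝ) : ℝ := (∫⁻ y in Ioo a x, g y).toReal - t * x

section

variable {g : ℝ → ℝ≥0∞} {t a c : ℝ}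

theorem continuousOn_tilted (hg : AEMeasurable g volume) (hfin : ∫⁻ y in Ioo a c, g y ≠ ∞) :
    ContinuousOn (tilted g t a) (Icc a c) :=
  (continuousOn_toReal_setLIntegral hg hfin).sub (by fun_prop)

theorem tilted_sub (hfin : ∫⁻ y in Ioo a c, g y ≠ ∞) {x y : ℝ} (hax : a ≤ x) (hxy : x ≤ y)
    (hyc : y ≤ c) :
    tilted g t a y - tilted g t a x = (∫⁻ z in Ioo x y, g z).toReal - t * (y - x) := by
  have h1 : ∫⁻ z in Ioo a x, g z ≠ ∞ := ne_top_of_le_ne_top hfin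
    (lintegral_mono_set (Ioo_subset_Ioo_right (hxy.trans hyc)))
  have h2 : ∫⁻ z in Ioo x y, g z ≠ ∞ := ne_top_of_le_ne_top hfin
    (lintegral_mono_set (Ioo_subset_Ioo hax hyc))
  rw [tilted, tilted, setLIntegral_Ioo_add g hax hxy, ENNReal.toReal_add h1 h2]
  ring

theorem tilted_le_iff (hfin : ∫⁻ y in Ioo a c, g y ≠ ∞) {x y : ℝ} (hax : a ≤ x)
    (hxy : x ≤ y) (hyc : y ≤ c) :
    tilted g t a x ≤ tilted g t a y ↔ ENNReal.ofReal (t * (y - x)) ≤ ∫⁻ z in Ioo x y, g z := by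
  have h2 : ∫⁻ z in Ioo x y, g z ≠ ∞ := ne_top_of_le_ne_top hfin
    (lintegral_mono_set (Ioo_subset_Ioo hax hyc))
  rw [ENNReal.ofReal_le_iff_le_toReal h2, ← sub_nonneg, tilted_sub hfin hax hxy hyc, sub_nonneg]

theorem tilted_lt_iff (ht : 0 ≤ t) (hfin : ∫⁻ y in Ioo a c, g y ≠ ∞) {x y : ℝ} (hax : a ≤ x)
    (hxy : x ≤ y) (hyc : y ≤ c) :
    tilted g t a x < tilted g t a y ↔ ENNReal.ofReal (t * (y - x)) < ∫⁻ z in Ioo x y, g z := by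
  have h2 : ∫⁻ z in Ioo x y, g z ≠ ∞ := ne_top_of_le_ne_top hfin
    (lintegral_mono_set (Ioo_subset_Ioo hax hyc))
  rw [ENNReal.ofReal_lt_iff_lt_toReal (mul_nonneg ht (sub_nonneg.2 hxy)) h2, ← sub_pos,
    tilted_sub hfin hax hxy hyc, sub_pos]

theorem risingSun_tilted (ht : 0 ≤ t) (hfin : ∫⁻ y in Ioo a c, g y ≠ ∞) :
    risingSun (tilted g t a) a c = levelSet g t a c := by
  ext x
  refine and_congr_right fun hx => exists_congr fun y => and_congr_right fun hy => ?_
  exact tilted_lt_iff ht hfin hx.1.le hy.1.le hy.2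

/-- On a component `(α, β)`, maximality of `tilted g t a β` says that `g` has mean at least `t` over
every `(x, β)`, which is what the halving argument needs. The hypothesis has the shape in which
`A_p⁺` is used: `μ` on `(x, y)` against the mass of `g` on `(y, z)`. -/
theorem measure_levelSet_le (hg : AEMeasurable g volume) (ht : 0 < t)
    (hfin : ∫⁻ y in Ioo a c, g y ≠ ∞) {μ ν : Measure ℝ}
    [NullSingletonClass μ] [NullSingletonClass ν]
    (h : ∀ x y z, a ≤ x → x < y → y < z → z ≤ c →
      ENNReal.ofReal (t * (z - x)) ≤ 4 * ∫⁻ s in Ioo y z, g s → μ (Ioo x y) ≤ ν (Ioo x z)) :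
    μ (levelSet g t a c) ≤ 2 * ν (levelSet g t a c) := by
  rw [← risingSun_tilted ht.le hfin]
  have key : μ (risingSun (tilted g t a) a c) ≤ ((2 : ℝ≥0∞) • ν) (risingSun (tilted g t a) a c) := by
    refine measure_risingSun_le (continuousOn_tilted hg hfin) ?_
    intro α β haα hαβ hβc _ hmax _
    rw [Measure.smul_apply, smul_eq_mul]
    refine measure_Ioo_le_of_halving hg hαβ ht ?_ ?_ ?_
    · exact ne_top_of_le_ne_top hfin (lintegral_mono_set (Ioo_subset_Ioo haα hβc))
    · intro x hx
      exact (tilted_le_iff hfin (haα.trans hx.1.le) hx.2.le hβc).1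
        (hmax x ⟨hx.1, hx.2.le.trans hβc⟩)
    · intro x y z hx hxy hyz hz hle
      exact h x y z (haα.trans hx) hxy hyz (hz.trans hβc) hle
  simpa using key

end

/-! ### One-sided Muckenhoupt weights -/

section

variable {p : ℝ} {w : ℝ → ℝ≥0∞}

theorem weight_mul_dual_le (hp : 1 < p) {a b c : ℝ} (hab : a < b) (hbc : b < c) :
    (∫⁻ x in Ioo a b, w x) * (∫⁻ x in Ioo b c, w x ^ (-1 / (p - 1))) ^ (p - 1) ≤
      apPlusConst p w * ENNReal.ofReal (c - a) ^ p := by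
  have h : ((∫⁻ x in Ioo a b, w x) / ENNReal.ofReal (c - a)) *
      ((∫⁻ x in Ioo b c, w x ^ (-1 / (p - 1))) / ENNReal.ofReal (c - a)) ^ (p - 1) ≤
        apPlusConst p w :=
    le_iSup_of_le a (le_iSup_of_le b (le_iSup_of_le c (le_iSup_of_le hab (le_iSup_of_le hbc le_rfl))))
  have hd0 : ENNReal.ofReal (c - a) ≠ 0 := by simp; linarith
  have hdt : ENNReal.ofReal (c - a) ≠ ∞ := ENNReal.ofReal_ne_top
  set d := ENNReal.ofReal (c - a)
  set A := ∫⁻ x in Ioo a b, w x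
  set B := ∫⁻ x in Ioo b c, w x ^ (-1 / (p - 1))
  have hdp : d ^ p = d * d ^ (p - 1) := by
    conv_rhs => rw [← ENNReal.rpow_one d, ← ENNReal.rpow_mul, one_mul,
      ← ENNReal.rpow_add _ _ hd0 hdt]
    congr 1
    ring
  calc A * B ^ (p - 1) = (A / d * d) * (B / d * d) ^ (p - 1) := by
        rw [ENNReal.div_mul_cancel hd0 hdt, ENNReal.div_mul_cancel hd0 hdt]
    _ = (A / d * (B / d) ^ (p - 1)) * d ^ p := by
        rw [ENNReal.mul_rpow_of_nonneg _ _ (by linarith), hdp]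
        ring
    _ ≤ _ := by gcongr

/-- Otherwise a positive factor times an infinite one would make the `A_p⁺` product infinite. -/
theorem dual_ne_top (hp : 1 < p) (hA : apPlusConst p w ≠ ∞) {a b c : ℝ} (hab : a < b)
    (h0 : ∫⁻ x in Ioo a b, w x ≠ 0) : ∫⁻ x in Ioo b c, w x ^ (-1 / (p - 1)) ≠ ∞ := by
  rcases le_or_gt c b with hcb | hbc
  · simp [Ioo_eq_empty_of_le hcb]
  intro htop
  have h := weight_mul_dual_le (w := w) hp hab hbc
  rw [htop, ENNReal.top_rpow_of_pos (by linarith), ENNReal.mul_top h0, top_le_iff] at h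
  exact ENNReal.mul_ne_top hA (ENNReal.rpow_ne_top_of_nonneg (by linarith) ENNReal.ofReal_ne_top) h

theorem aemeasurable_dual (hw : AEMeasurable w volume) :
    AEMeasurable (fun x => w x ^ (-1 / (p - 1))) volume := hw.pow_const _

theorem neg_one_div_neg (hp : 1 < p) : -1 / (p - 1) < 0 := by
  rw [neg_div, neg_lt_zero]
  exact one_div_pos.2 (by linarith)

theorem dual_ne_zero (hp : 1 < p) (hw : AEMeasurable w volume) (hwt : ∀ x, w x ≠ ∞) {a c : ℝ}
    (hac : a < c) : ∫⁻ x in Ioo a c, w x ^ (-1 / (p - 1)) ≠ 0 := by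
  intro h
  rw [lintegral_eq_zero_iff' (aemeasurable_dual hw).restrict] at h
  have h3 : ∀ᵐ x ∂volume.restrict (Ioo a c), False := by
    filter_upwards [h] with x hx
    simp only [Pi.zero_apply, ENNReal.rpow_eq_zero_iff] at hx
    rcases hx with ⟨_, hx⟩ | ⟨hx, _⟩
    · linarith [neg_one_div_neg hp]
    · exact hwt x hx
  rw [eventually_false_iff_eq_bot, ae_eq_bot, Measure.restrict_eq_zero, Real.volume_Ioo,
    ENNReal.ofReal_eq_zero] at h3
  linarith

/-- Level sets of the maximal function of the dual weight have small `w`-measure. -/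
theorem weight_levelSet_dual_le (hp : 1 < p) (hw : AEMeasurable w volume)
    {a c t : ℝ} (ht : 0 < t)
    (hfin : ∫⁻ x in Ioo a c, w x ^ (-1 / (p - 1)) ≠ ∞) :
    ENNReal.ofReal t ^ (p - 1) * (volume.withDensity w)
        (levelSet (fun x => w x ^ (-1 / (p - 1))) t a c) ≤
      2 * 4 ^ (p - 1) * apPlusConst p w *
        volume (levelSet (fun x => w x ^ (-1 / (p - 1))) t a c) := by
  have hp1 : 0 ≤ p - 1 := by linarith
  set σ : ℝ → ℝ≥0∞ := fun x => w x ^ (-1 / (p - 1)) with hσ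
  set T := ENNReal.ofReal t ^ (p - 1) with hT
  have hT0 : T ≠ 0 := by simp [hT, ht]
  have hTt : T ≠ ∞ := ENNReal.rpow_ne_top_of_nonneg hp1 ENNReal.ofReal_ne_top
  -- The comparison measure is a multiple of Lebesgue measure: the mass condition raised to the
  -- power `p - 1` and inserted in the `A_p⁺` product bounds `w (x, y)` by a multiple of `t^{1-p} (z
  -- - x)`.
  have h := measure_levelSet_le (g := σ) (aemeasurable_dual hw) ht hfin
    (μ := volume.withDensity w)
    (ν := volume.withDensity fun _ => 4 ^ (p - 1) * apPlusConst p w / T) ?_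
  · rw [withDensity_const, Measure.smul_apply, smul_eq_mul] at h
    calc T * (volume.withDensity w) (levelSet σ t a c)
        ≤ T * (2 * (4 ^ (p - 1) * apPlusConst p w / T * volume (levelSet σ t a c))) := by gcongr
      _ = (T / T) * (2 * 4 ^ (p - 1) * apPlusConst p w * volume (levelSet σ t a c)) := by
          simp only [div_eq_mul_inv]
          ring
      _ = _ := by rw [ENNReal.div_self hT0 hTt, one_mul]
  · intro x y z _ hxy hyz _ hle
    rw [withDensity_const, Measure.smul_apply, smul_eq_mul, Real.volume_Ioo,
      withDensity_apply _ measurableSet_Ioo]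
    have h1 := weight_mul_dual_le (w := w) hp hxy hyz
    have hd0 : ENNReal.ofReal (z - x) ≠ 0 := by simp; linarith
    have hdt : ENNReal.ofReal (z - x) ≠ ∞ := ENNReal.ofReal_ne_top
    rw [ENNReal.ofReal_mul ht.le] at hle
    set d := ENNReal.ofReal (z - x)
    have hd'0 : d ^ (p - 1) ≠ 0 := by simp [hd0, hdt]
    have hd't : d ^ (p - 1) ≠ ∞ := ENNReal.rpow_ne_top_of_nonneg hp1 hdt
    have hdp : d ^ p = d * d ^ (p - 1) := by
      conv_rhs => rw [← ENNReal.rpow_one d, ← ENNReal.rpow_mul, one_mul,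
        ← ENNReal.rpow_add _ _ hd0 hdt]
      congr 1
      ring
    have h2 := ENNReal.rpow_le_rpow hle hp1
    rw [ENNReal.mul_rpow_of_nonneg _ _ hp1, ENNReal.mul_rpow_of_nonneg _ _ hp1] at h2
    have h3 : (∫⁻ s in Ioo x y, w s) * T ≤ 4 ^ (p - 1) * apPlusConst p w * d := by
      rw [← ENNReal.mul_le_mul_iff_left hd'0 hd't]
      calc (∫⁻ s in Ioo x y, w s) * T * d ^ (p - 1)
          = (∫⁻ s in Ioo x y, w s) * (T * d ^ (p - 1)) := by ring
        _ ≤ (∫⁻ s in Ioo x y, w s) * (4 ^ (p - 1) * (∫⁻ s in Ioo y z, σ s) ^ (p - 1)) := by gcongr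
        _ = 4 ^ (p - 1) * ((∫⁻ s in Ioo x y, w s) * (∫⁻ s in Ioo y z, σ s) ^ (p - 1)) := by ring
        _ ≤ 4 ^ (p - 1) * (apPlusConst p w * d ^ p) := by gcongr
        _ = 4 ^ (p - 1) * apPlusConst p w * d * d ^ (p - 1) := by rw [hdp]; ring
    rw [ENNReal.div_eq_inv_mul, mul_assoc, ← ENNReal.div_eq_inv_mul]
    exact (ENNReal.le_div_iff_mul_le (Or.inl hT0) (Or.inl hTt)).2 h3

/-- Hölder's inequality for `g = (g w^{1/p}) w^{-1/p}`; this factorization is valid only where `w ≠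
0`. -/
theorem lintegral_rpow_le_mul_dual (hp : 1 < p) (hw : AEMeasurable w volume) (hwt : ∀ x, w x ≠ ∞)
    {g : ℝ → ℝ≥0∞} (hg : AEMeasurable g volume) {J : Set ℝ}
    (h0 : ∀ᵐ x ∂volume.restrict J, w x ≠ 0) :
    (∫⁻ x in J, g x) ^ p ≤
      (∫⁻ x in J, w x * g x ^ p) * (∫⁻ x in J, w x ^ (-1 / (p - 1))) ^ (p - 1) := by
  have hp0 : 0 < p := by linarith
  have hp1 : 0 < p - 1 := by linarith
  have hconj : p.HolderConjugate (p.conjExponent) := .conjExponent hp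
  have h1 : ∫⁻ x in J, g x = ∫⁻ x in J, ((fun x => g x * w x ^ (1 / p)) *
      fun x => w x ^ (-1 / p)) x := by
    refine lintegral_congr_ae ?_
    filter_upwards [h0] with x hx
    rw [Pi.mul_apply, mul_assoc, ← ENNReal.rpow_add _ _ hx (hwt x)]
    simp [neg_div]
  have h2 := ENNReal.lintegral_mul_le_Lp_mul_Lq (volume.restrict J) hconj
    (f := fun x => g x * w x ^ (1 / p)) (g := fun x => w x ^ (-1 / p))
    (hg.restrict.mul (hw.restrict.pow_const _)) (hw.restrict.pow_const _)
  rw [← h1] at h2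
  refine (ENNReal.rpow_le_rpow h2 hp0.le).trans_eq ?_
  rw [ENNReal.mul_rpow_of_nonneg _ _ hp0.le, ← ENNReal.rpow_mul, ← ENNReal.rpow_mul]
  congr 1
  · rw [one_div, inv_mul_cancel₀ hp0.ne', ENNReal.rpow_one]
    refine lintegral_congr fun x => ?_
    rw [ENNReal.mul_rpow_of_nonneg _ _ hp0.le, ← ENNReal.rpow_mul,
      inv_mul_cancel₀ hp0.ne', ENNReal.rpow_one, mul_comm]
  · congr 1
    · refine lintegral_congr fun x => ?_
      rw [← ENNReal.rpow_mul, Real.conjExponent]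
      congr 1
      field_simp
    · rw [Real.conjExponent]
      field_simp

/-- Hölder on `(y, z)` trades the mass of `g` for the integral of `w g^p` and a power of the dual
mass, and `A_p⁺` absorbs the latter together with `w (x, y)`. -/
theorem weight_levelSet_le (hp : 1 < p) (hw : AEMeasurable w volume) (hwt : ∀ x, w x ≠ ∞)
    (hA : apPlusConst p w ≠ ∞)
    {g : ℝ → ℝ≥0∞} (hg : AEMeasurable g volume) {a c t : ℝ} (ht : 0 < t)
    (h0 : ∀ᵐ x ∂volume.restrict (Ioo a c), w x ≠ 0) (hfin : ∫⁻ x in Ioo a c, g x ≠ ∞) :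
    ENNReal.ofReal t ^ p * (volume.withDensity w) (levelSet g t a c) ≤
      2 * 4 ^ p * apPlusConst p w * ∫⁻ x in Ioo a c, w x * g x ^ p := by
  have hp0 : 0 ≤ p := by linarith
  set T := ENNReal.ofReal t ^ p with hT
  have hT0 : T ≠ 0 := by simp [hT, ht]
  have hTt : T ≠ ∞ := ENNReal.rpow_ne_top_of_nonneg hp0 ENNReal.ofReal_ne_top
  have h4t : (4 : ℝ≥0∞) ^ p ≠ ∞ := ENNReal.rpow_ne_top_of_nonneg hp0 ENNReal.ofNat_ne_top
  have hCt : 4 ^ p * apPlusConst p w / T ≠ ∞ := ENNReal.div_ne_top (ENNReal.mul_ne_top h4t hA) hT0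
  have hν : ∀ s, MeasurableSet s → (volume.withDensity fun x =>
      (4 ^ p * apPlusConst p w / T) * (w x * g x ^ p)) s =
      4 ^ p * apPlusConst p w / T * ∫⁻ x in s, w x * g x ^ p := by
    intro s hs
    rw [withDensity_apply _ hs, lintegral_const_mul' _ _ hCt]
  have h := measure_levelSet_le hg ht hfin (μ := volume.withDensity w)
    (ν := volume.withDensity fun x => (4 ^ p * apPlusConst p w / T) * (w x * g x ^ p)) ?_
  · rw [hν _ (measurableSet_levelSet g ht.le)] at h
    calc T * (volume.withDensity w) (levelSet g t a c)
        ≤ T * (2 * (4 ^ p * apPlusConst p w / T * ∫⁻ x in Ioo a c, w x * g x ^ p)) := by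
          gcongr
          refine h.trans ?_
          gcongr
          exact levelSet_subset g t a c
      _ = (T / T) * (2 * 4 ^ p * apPlusConst p w * ∫⁻ x in Ioo a c, w x * g x ^ p) := by
          simp only [div_eq_mul_inv]
          ring
      _ = _ := by rw [ENNReal.div_self hT0 hTt, one_mul]
  · intro x y z hax hxy hyz hzc hle
    rw [hν _ measurableSet_Ioo, withDensity_apply _ measurableSet_Ioo]
    have h1 := weight_mul_dual_le (w := w) hp hxy hyz
    have hd0 : ENNReal.ofReal (z - x) ≠ 0 := by simp; linarith
    have hdt : ENNReal.ofReal (z - x) ≠ ∞ := ENNReal.ofReal_ne_top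
    rw [ENNReal.ofReal_mul ht.le] at hle
    set d := ENNReal.ofReal (z - x)
    have hd'0 : d ^ p ≠ 0 := by simp [hd0, hdt]
    have hd't : d ^ p ≠ ∞ := ENNReal.rpow_ne_top_of_nonneg hp0 hdt
    have h2 := ENNReal.rpow_le_rpow hle hp0
    rw [ENNReal.mul_rpow_of_nonneg _ _ hp0, ENNReal.mul_rpow_of_nonneg _ _ hp0] at h2
    have h5 := lintegral_rpow_le_mul_dual hp hw hwt hg (J := Ioo y z)
      (ae_restrict_of_ae_restrict_of_subset (Ioo_subset_Ioo (hax.trans hxy.le) hzc) h0)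
    set B := (∫⁻ s in Ioo y z, w s ^ (-1 / (p - 1))) ^ (p - 1)
    have h3 : (∫⁻ s in Ioo x y, w s) * T ≤
        4 ^ p * apPlusConst p w * ∫⁻ s in Ioo x z, w s * g s ^ p := by
      rw [← ENNReal.mul_le_mul_iff_left hd'0 hd't]
      calc (∫⁻ s in Ioo x y, w s) * T * d ^ p
          = (∫⁻ s in Ioo x y, w s) * (T * d ^ p) := by ring
        _ ≤ (∫⁻ s in Ioo x y, w s) * (4 ^ p * ((∫⁻ s in Ioo y z, w s * g s ^ p) * B)) := by
            refine mul_le_mul_right (h2.trans ?_) _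
            gcongr
        _ = 4 ^ p * ((∫⁻ s in Ioo x y, w s) * B) * ∫⁻ s in Ioo y z, w s * g s ^ p := by ring
        _ ≤ 4 ^ p * (apPlusConst p w * d ^ p) * ∫⁻ s in Ioo x z, w s * g s ^ p := by
            gcongr
        _ = _ := by ring
    rw [ENNReal.div_eq_inv_mul, mul_assoc, ← ENNReal.div_eq_inv_mul]
    exact (ENNReal.le_div_iff_mul_le (Or.inl hT0) (Or.inl hTt)).2 h3

/-! ### The half-line carrying the weight -/

/-- The half-line of points that have some mass of `w` to their left. -/
def rightSupport (w : ℝ → ℝ≥0∞) : Set ℝ := {x | (volume.withDensity w) (Iio x) ≠ 0}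

theorem mem_rightSupport_of_le {x y : ℝ} (hx : x ∈ rightSupport w) (hxy : x ≤ y) :
    y ∈ rightSupport w := fun h => hx (measure_mono_null (Iio_subset_Iio hxy) h)

theorem exists_rat_lt_of_mem_rightSupport {x : ℝ} (hx : x ∈ rightSupport w) :
    ∃ q : ℚ, (q : ℝ) < x ∧ (q : ℝ) ∈ rightSupport w := by
  by_contra! h
  apply hx
  have hsub : Iio x ⊆ ⋃ q : {q : ℚ // (q : ℝ) < x}, Iio ((q : ℚ) : ℝ) := by
    intro z hz
    obtain ⟨q, hq1, hq2⟩ := exists_rat_btwn (show z < x from hz)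
    exact mem_iUnion.2 ⟨⟨q, hq2⟩, hq1⟩
  refine measure_mono_null hsub (measure_iUnion_null fun q => ?_)
  have := h q q.2
  simpa [rightSupport] using this

theorem exists_Ioo_of_mem_rightSupport {x : ℝ} (hx : x ∈ rightSupport w) :
    ∃ a < x, ∫⁻ y in Ioo a x, w y ≠ 0 := by
  by_contra! h
  apply hx
  have hsub : Iio x ⊆ ⋃ n : ℕ, Ioo (x - (n + 1)) x := by
    intro z hz
    obtain ⟨n, hn⟩ := exists_nat_gt (x - z)
    exact mem_iUnion.2 ⟨n, by linarith, hz⟩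
  refine measure_mono_null hsub (measure_iUnion_null fun n => ?_)
  rw [withDensity_apply _ measurableSet_Ioo]
  exact h _ (by linarith [(Nat.cast_nonneg n : (0 : ℝ) ≤ n)])

/-- The complement is a lower set. A point of it that is not maximal has a null neighbourhood `Iio
y`; for a maximal point `x` the set lies in `Iic x`, which exceeds the null `Iio x` by one point. -/
theorem weight_compl_rightSupport : (volume.withDensity w) (rightSupport w)ᶜ = 0 := by
  refine measure_null_of_locally_null _ fun x hx => ?_
  have hx' : (volume.withDensity w) (Iio x) = 0 := not_not.1 hx
  by_cases hmax : ∃ y ∈ (rightSupport w)ᶜ, x < y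
  · obtain ⟨y, hy, hxy⟩ := hmax
    exact ⟨Iio y, mem_nhdsWithin_of_mem_nhds (Iio_mem_nhds hxy), not_not.1 hy⟩
  · push Not at hmax
    refine ⟨Iic x, mem_of_superset self_mem_nhdsWithin fun y hy => hmax y hy, ?_⟩
    rwa [← measure_congr (Iio_ae_eq_Iic (μ := volume.withDensity w))]

/-- This removes the degenerate part of the line: estimates need only be proved to the right of a
point `a` where the dual weight is locally integrable. Rational `a` suffice, giving a countable
directed union. -/
theorem weight_le_of_forall_rightSupport {S : Set ℝ} {K : ℝ≥0∞}
    (h : ∀ a ∈ rightSupport w, (volume.withDensity w) (S ∩ Ioi a) ≤ K) :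
    (volume.withDensity w) S ≤ K := by
  have hsub : S ⊆ (⋃ q : {q : ℚ // (q : ℝ) ∈ rightSupport w}, S ∩ Ioi ((q : ℚ) : ℝ)) ∪
      (rightSupport w)ᶜ := by
    intro x hx
    by_cases hxU : x ∈ rightSupport w
    · obtain ⟨q, hq1, hq2⟩ := exists_rat_lt_of_mem_rightSupport hxU
      exact Or.inl (mem_iUnion.2 ⟨⟨q, hq2⟩, hx, hq1⟩)
    · exact Or.inr hxU
  refine (measure_mono hsub).trans ((measure_union_le _ _).trans ?_)
  rw [weight_compl_rightSupport, add_zero, Directed.measure_iUnion]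
  · exact iSup_le fun q => h q q.2
  · refine Antitone.directed_le fun q r hqr => inter_subset_inter_right _ (Ioi_subset_Ioi ?_)
    exact_mod_cast hqr

theorem dual_ne_top_of_mem_rightSupport (hp : 1 < p) (hA : apPlusConst p w ≠ ∞) {x : ℝ}
    (hx : x ∈ rightSupport w) (c : ℝ) : ∫⁻ y in Ioo x c, w y ^ (-1 / (p - 1)) ≠ ∞ := by
  obtain ⟨a, hax, h0⟩ := exists_Ioo_of_mem_rightSupport hx
  exact dual_ne_top hp hA hax h0

theorem ae_ne_zero_of_dual_ne_top (hp : 1 < p) (hw : AEMeasurable w volume) {s : Set ℝ}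
    (h : ∫⁻ y in s, w y ^ (-1 / (p - 1)) ≠ ∞) : ∀ᵐ x ∂volume.restrict s, w x ≠ 0 := by
  filter_upwards [ae_lt_top' (aemeasurable_dual hw).restrict h] with x hx h0
  rw [h0, ENNReal.zero_rpow_of_neg] at hx
  · exact lt_irrefl _ hx
  · exact neg_one_div_neg hp

theorem ae_ne_zero_of_mem_rightSupport (hp : 1 < p) (hw : AEMeasurable w volume)
    (hA : apPlusConst p w ≠ ∞) {a : ℝ} (ha : a ∈ rightSupport w) :
    ∀ᵐ x ∂volume.restrict (Ioi a), w x ≠ 0 := by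
  have hU : Ioi a = ⋃ n : ℕ, Ioo a (a + n) := by
    apply Subset.antisymm
    · intro z hz
      obtain ⟨n, hn⟩ := exists_nat_gt (z - a)
      exact mem_iUnion.2 ⟨n, hz, by linarith⟩
    · exact iUnion_subset fun n => Ioo_subset_Ioi_self
  rw [hU, ae_restrict_iUnion_iff]
  exact fun n => ae_ne_zero_of_dual_ne_top hp hw (dual_ne_top_of_mem_rightSupport hp hA ha _)

/-- The weak type `(p, p)` inequality for `M⁺` with respect to an `A_p⁺` weight. -/
theorem weight_lt_maximalPlus_le (hp : 1 < p) (hw : AEMeasurable w volume) (hwt : ∀ x, w x ≠ ∞)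
    (hA : apPlusConst p w ≠ ∞) {g : ℝ → ℝ≥0∞} (hg : AEMeasurable g volume) {t : ℝ} (ht : 0 < t) :
    ENNReal.ofReal t ^ p * (volume.withDensity w) {x | ENNReal.ofReal t < maximalPlus g x} ≤
      2 * 4 ^ p * apPlusConst p w * ∫⁻ x, w x * g x ^ p := by
  have hp0 : 0 < p := by linarith
  rcases eq_or_ne (apPlusConst p w * ∫⁻ x, w x * g x ^ p) ∞ with htop | htop
  · rw [mul_assoc, htop, ENNReal.mul_top (by simp)]
    exact le_top
  set T := ENNReal.ofReal t ^ p with hT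
  have hT0 : T ≠ 0 := by simp [hT, ht]
  have hTt : T ≠ ∞ := ENNReal.rpow_ne_top_of_nonneg hp0.le ENNReal.ofReal_ne_top
  rw [mul_comm, ← ENNReal.le_div_iff_mul_le (Or.inl hT0) (Or.inl hTt)]
  refine weight_le_of_forall_rightSupport fun a ha => ?_
  have hsub : {x | ENNReal.ofReal t < maximalPlus g x} ∩ Ioi a ⊆
      ⋃ n : ℕ, levelSet g t a (a + n) := by
    rintro x ⟨hx, hax⟩
    obtain ⟨y, hxy, hlt⟩ := (lt_maximalPlus_iff ht.le).1 hx
    obtain ⟨n, hn⟩ := exists_nat_gt (y - a)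
    exact mem_iUnion.2 ⟨n, ⟨hax, by linarith⟩, y, ⟨hxy, by linarith⟩, hlt⟩
  refine (measure_mono hsub).trans ?_
  rw [Directed.measure_iUnion]
  swap
  · refine Monotone.directed_le fun m n hmn => ?_
    have hmn' : (m : ℝ) ≤ n := by exact_mod_cast hmn
    rintro x ⟨hx, y, hy, hlt⟩
    exact ⟨⟨hx.1, by linarith [hx.2]⟩, y, ⟨hy.1, by linarith [hy.2]⟩, hlt⟩
  refine iSup_le fun n => ?_
  rw [ENNReal.le_div_iff_mul_le (Or.inl hT0) (Or.inl hTt), mul_comm]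
  have h0 : ∀ᵐ x ∂volume.restrict (Ioo a (a + n)), w x ≠ 0 :=
    ae_restrict_of_ae_restrict_of_subset Ioo_subset_Ioi_self
      (ae_ne_zero_of_mem_rightSupport hp hw hA ha)
  -- The product of the constant and this integral is finite, so an infinite integral forces
  -- `apPlusConst p w = 0`, and then `w` has no mass on the interval.
  rcases eq_or_ne (∫⁻ x, w x * g x ^ p) ∞ with hgt | hgt
  · have hA0 : apPlusConst p w = 0 := by
      by_contra hne
      exact htop (by rw [hgt, ENNReal.mul_top hne])
    have hzero : (volume.withDensity w) (Ioo a (a + n)) = 0 := by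
      rw [withDensity_apply _ measurableSet_Ioo]
      rcases le_or_gt (a + n) a with hle | hlt
      · simp [Ioo_eq_empty_of_le hle]
      have h1 := weight_mul_dual_le (w := w) hp hlt (lt_add_one (a + n))
      rw [hA0, zero_mul, nonpos_iff_eq_zero, mul_eq_zero] at h1
      refine h1.resolve_right fun h2 => ?_
      rw [ENNReal.rpow_eq_zero_iff_of_pos (by linarith)] at h2
      exact dual_ne_zero hp hw hwt (lt_add_one _) h2
    rw [measure_mono_null (levelSet_subset _ _ _ _) hzero, mul_zero]
    exact zero_le
  · have hgfin : ∫⁻ x in Ioo a (a + n), g x ≠ ∞ := by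
      intro hgi
      have h1 := lintegral_rpow_le_mul_dual hp hw hwt hg h0
      rw [hgi, ENNReal.top_rpow_of_pos hp0, top_le_iff] at h1
      refine ENNReal.mul_ne_top ?_ ?_ h1
      · exact ne_top_of_le_ne_top hgt (setLIntegral_le_lintegral _ _)
      · exact ENNReal.rpow_ne_top_of_nonneg (by linarith)
          (dual_ne_top_of_mem_rightSupport hp hA ha _)
    refine (weight_levelSet_le hp hw hwt hA hg ht h0 hgfin).trans ?_
    gcongr
    exact Measure.restrict_le_self

end

/-! ### Layer cake formulas -/

section

variable {Ω : Type*} [MeasurableSpace Ω]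

theorem lintegral_lintegral_ite_lt (ν : Measure Ω) [SFinite ν] {f : Ω → ℝ≥0∞} (hf : Measurable f)
    {φ : ℝ → ℝ≥0∞} (hφ : Measurable φ) (s : Set ℝ) :
    ∫⁻ x, (∫⁻ t in s, if ENNReal.ofReal t < f x then φ t else 0) ∂ν =
      ∫⁻ t in s, φ t * ν {x | ENNReal.ofReal t < f x} := by
  rw [lintegral_lintegral_swap]
  · refine lintegral_congr fun t => ?_
    have hm : MeasurableSet {x | ENNReal.ofReal t < f x} := measurableSet_lt measurable_const hf
    rw [← lintegral_indicator_const hm]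
    refine lintegral_congr fun x => ?_
    simp [indicator_apply]
  · refine Measurable.aemeasurable ?_
    refine Measurable.ite ?_ (hφ.comp measurable_snd) measurable_const
    exact measurableSet_lt (ENNReal.measurable_ofReal.comp measurable_snd) (hf.comp measurable_fst)

theorem volume_Ioi_inter_ofReal_lt (s : ℝ≥0∞) :
    ∫⁻ t in Ioi (0 : ℝ), (if ENNReal.ofReal t < s then (1 : ℝ≥0∞) else 0) = s := by
  have h : ∀ t : ℝ, (if ENNReal.ofReal t < s then (1 : ℝ≥0∞) else 0) =
      {t : ℝ | ENNReal.ofReal t < s}.indicator (fun _ => 1) t := fun t => by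
    simp [indicator_apply]
  have hm : MeasurableSet {t : ℝ | ENNReal.ofReal t < s} :=
    measurableSet_lt ENNReal.measurable_ofReal measurable_const
  simp only [h]
  rw [lintegral_indicator_const hm, one_mul, Measure.restrict_apply hm]
  rcases eq_or_ne s ∞ with rfl | hs
  · simp
  · have : {t : ℝ | ENNReal.ofReal t < s} ∩ Ioi 0 = Ioo 0 s.toReal := by
      ext t
      simp only [mem_inter_iff, mem_ofPred_eq, mem_Ioi, mem_Ioo]
      constructor
      · rintro ⟨h1, h2⟩
        exact ⟨h2, (ENNReal.ofReal_lt_iff_lt_toReal h2.le hs).1 h1⟩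
      · rintro ⟨h2, h1⟩
        exact ⟨(ENNReal.ofReal_lt_iff_lt_toReal h2.le hs).2 h1, h2⟩
    rw [this, Real.volume_Ioo, sub_zero, ENNReal.ofReal_toReal hs]

theorem lintegral_eq_lintegral_meas_ofReal_lt (ν : Measure Ω) [SFinite ν] {f : Ω → ℝ≥0∞}
    (hf : AEMeasurable f ν) :
    ∫⁻ x, f x ∂ν = ∫⁻ t in Ioi (0 : ℝ), ν {x | ENNReal.ofReal t < f x} := by
  have h := lintegral_lintegral_ite_lt ν hf.measurable_mk (φ := fun _ => 1) measurable_const (Ioi 0)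
  simp only [volume_Ioi_inter_ofReal_lt, one_mul] at h
  rw [lintegral_congr_ae hf.ae_eq_mk, h]
  refine lintegral_congr fun t => measure_congr ?_
  filter_upwards [hf.ae_eq_mk] with x hx
  exact congrArg (ENNReal.ofReal t < ·) hx.symm

theorem setLIntegral_rpow_sub_one {δ l u : ℝ} (hδ : 0 < δ) (hl : 0 ≤ l) (hlu : l ≤ u) :
    ∫⁻ t in Ioo l u, ENNReal.ofReal (δ * t ^ (δ - 1)) = ENNReal.ofReal (u ^ δ - l ^ δ) := by
  have hint : IntervalIntegrable (fun t : ℝ => δ * t ^ (δ - 1)) volume l u :=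
    (intervalIntegral.intervalIntegrable_rpow' (by linarith)).const_mul δ
  rw [setLIntegral_congr (Ioo_ae_eq_Ioc (μ := (volume : Measure ℝ))),
    ← ofReal_integral_eq_lintegral_ofReal ((intervalIntegrable_iff_integrableOn_Ioc_of_le hlu).1 hint),
    ← intervalIntegral.integral_of_le hlu, intervalIntegral.integral_const_mul,
    integral_rpow (Or.inl (by linarith))]
  · congr 1
    rw [sub_add_cancel]
    field_simp
  · filter_upwards [ae_restrict_mem measurableSet_Ioc] with t ht
    have : 0 ≤ t := hl.trans ht.1.le
    positivity

/-- Integration of the derivative of `t^δ` from `l` up to the truncated value; below `l` the first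
term suffices. -/
theorem min_rpow_le_add {δ l N : ℝ} (hδ : 0 < δ) (hl : 0 ≤ l) (s : ℝ≥0∞) :
    min s (ENNReal.ofReal N) ^ δ ≤ ENNReal.ofReal l ^ δ +
      ∫⁻ t in Ioo l N, if ENNReal.ofReal t < s then ENNReal.ofReal (δ * t ^ (δ - 1)) else 0 := by
  have hmt : min s (ENNReal.ofReal N) ≠ ∞ :=
    ne_top_of_le_ne_top ENNReal.ofReal_ne_top (min_le_right _ _)
  set u := (min s (ENNReal.ofReal N)).toReal with hu
  have hu0 : 0 ≤ u := ENNReal.toReal_nonneg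
  have hmu : min s (ENNReal.ofReal N) = ENNReal.ofReal u := (ENNReal.ofReal_toReal hmt).symm
  rcases le_or_gt u l with hul | hlu
  · rw [hmu]
    exact le_add_right (by gcongr)
  · have hN : u ≤ N := by
      have h1 : ENNReal.ofReal u ≤ ENNReal.ofReal N := hmu ▸ min_le_right _ _
      exact (ENNReal.ofReal_le_ofReal_iff' .. |>.1 h1).resolve_right (by linarith)
    have h1 : ∫⁻ t in Ioo l u, ENNReal.ofReal (δ * t ^ (δ - 1)) ≤
        ∫⁻ t in Ioo l N, if ENNReal.ofReal t < s then ENNReal.ofReal (δ * t ^ (δ - 1)) else 0 := by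
      refine le_trans (setLIntegral_mono' measurableSet_Ioo fun t ht => ?_)
        (lintegral_mono_set (Ioo_subset_Ioo_right hN))
      rw [if_pos]
      refine lt_of_lt_of_le ?_ (hmu ▸ min_le_left s (ENNReal.ofReal N))
      exact (ENNReal.ofReal_lt_ofReal_iff (by linarith)).2 ht.2
    refine le_trans ?_ (add_le_add_right h1 _)
    rw [setLIntegral_rpow_sub_one hδ hl hlu.le, hmu, ENNReal.ofReal_rpow_of_nonneg hu0 hδ.le,
      ENNReal.ofReal_rpow_of_nonneg hl hδ.le, ← ENNReal.ofReal_add (by positivity)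
        (sub_nonneg.2 (Real.rpow_le_rpow hl hlu.le hδ.le))]
    rw [add_sub_cancel]

/-- On the domain of integration `t^δ` is at most the power of the truncated value, and the positive
`t` with `t < s` have total length `s`. -/
theorem setLIntegral_ite_rpow_le {δ l N : ℝ} (hδ : 0 < δ) (hl : 0 ≤ l) (s : ℝ≥0∞) :
    ∫⁻ t in Ioo l N, (if ENNReal.ofReal t < s then ENNReal.ofReal (δ * t ^ δ) else 0) ≤
      ENNReal.ofReal δ * min s (ENNReal.ofReal N) ^ δ * s := by
  calc ∫⁻ t in Ioo l N, (if ENNReal.ofReal t < s then ENNReal.ofReal (δ * t ^ δ) else 0)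
      ≤ ∫⁻ t in Ioo l N, ENNReal.ofReal δ * min s (ENNReal.ofReal N) ^ δ *
          (if ENNReal.ofReal t < s then (1 : ℝ≥0∞) else 0) := by
        refine setLIntegral_mono' measurableSet_Ioo fun t ht => ?_
        split_ifs with h
        · have ht0 : 0 ≤ t := hl.trans ht.1.le
          rw [mul_one, ENNReal.ofReal_mul hδ.le, ← ENNReal.ofReal_rpow_of_nonneg ht0 hδ.le]
          gcongr
          exact le_min h.le (ENNReal.ofReal_le_ofReal ht.2.le)
        · simp
    _ ≤ ∫⁻ t in Ioi 0, ENNReal.ofReal δ * min s (ENNReal.ofReal N) ^ δ *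
          (if ENNReal.ofReal t < s then (1 : ℝ≥0∞) else 0) :=
        lintegral_mono_set fun t ht => hl.trans_lt ht.1
    _ = _ := by
        rw [lintegral_const_mul', volume_Ioi_inter_ofReal_lt]
        refine ENNReal.mul_ne_top ENNReal.ofReal_ne_top ?_
        exact ENNReal.rpow_ne_top_of_nonneg hδ.le
          (ne_top_of_le_ne_top ENNReal.ofReal_ne_top (min_le_right _ _))

/-- A level set comparison `ν {G > t} ≤ K t m {G > t}` integrated against `d(t ^ δ)`. -/
theorem lintegral_min_rpow_le {ν m : Measure Ω} [SFinite ν] [SFinite m] {G : Ω → ℝ≥0∞}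
    (hG : Measurable G) {K : ℝ≥0∞} (hK : K ≠ ∞) {δ l : ℝ} (hδ : 0 < δ) (hl : 0 ≤ l) (N : ℝ)
    (h : ∀ t, l < t → ν {x | ENNReal.ofReal t < G x} ≤
      K * ENNReal.ofReal t * m {x | ENNReal.ofReal t < G x}) :
    ∫⁻ x, min (G x) (ENNReal.ofReal N) ^ δ ∂ν ≤ ENNReal.ofReal l ^ δ * ν univ +
      K * ENNReal.ofReal δ * ∫⁻ x, min (G x) (ENNReal.ofReal N) ^ δ * G x ∂m := by
  have hφ1 : Measurable fun t : ℝ => ENNReal.ofReal (δ * t ^ (δ - 1)) := by fun_prop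
  have hφ2 : Measurable fun t : ℝ => ENNReal.ofReal (δ * t ^ δ) := by fun_prop
  calc ∫⁻ x, min (G x) (ENNReal.ofReal N) ^ δ ∂ν
      ≤ ∫⁻ x, (ENNReal.ofReal l ^ δ + ∫⁻ t in Ioo l N,
          if ENNReal.ofReal t < G x then ENNReal.ofReal (δ * t ^ (δ - 1)) else 0) ∂ν :=
        lintegral_mono fun x => min_rpow_le_add hδ hl (G x)
    _ = ENNReal.ofReal l ^ δ * ν univ +
        ∫⁻ t in Ioo l N, ENNReal.ofReal (δ * t ^ (δ - 1)) * ν {x | ENNReal.ofReal t < G x} := by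
        rw [lintegral_add_left measurable_const, lintegral_const,
          lintegral_lintegral_ite_lt ν hG hφ1]
    _ ≤ ENNReal.ofReal l ^ δ * ν univ +
        ∫⁻ t in Ioo l N, K * (ENNReal.ofReal (δ * t ^ δ) * m {x | ENNReal.ofReal t < G x}) := by
        refine add_le_add_right (setLIntegral_mono' measurableSet_Ioo fun t ht => ?_) _
        have ht0 : 0 < t := hl.trans_lt ht.1
        have h2 : ENNReal.ofReal (δ * t ^ δ) =
            ENNReal.ofReal (δ * t ^ (δ - 1)) * ENNReal.ofReal t := by
          rw [← ENNReal.ofReal_mul (by positivity), mul_assoc, ← Real.rpow_add_one ht0.ne',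
            sub_add_cancel]
        rw [h2]
        refine (mul_le_mul_right (h t ht.1) _).trans_eq ?_
        ring
    _ = ENNReal.ofReal l ^ δ * ν univ + K * ∫⁻ x, (∫⁻ t in Ioo l N,
          if ENNReal.ofReal t < G x then ENNReal.ofReal (δ * t ^ δ) else 0) ∂m := by
        rw [lintegral_const_mul' _ _ hK, lintegral_lintegral_ite_lt m hG hφ2]
    _ ≤ ENNReal.ofReal l ^ δ * ν univ + K * ∫⁻ x, ENNReal.ofReal δ *
          (min (G x) (ENNReal.ofReal N) ^ δ * G x) ∂m := by
        gcongr with x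
        rw [← mul_assoc]
        exact setLIntegral_ite_rpow_le hδ hl (G x)
    _ = _ := by
        rw [lintegral_const_mul' _ _ ENNReal.ofReal_ne_top, mul_assoc]

end

/-! ### Lebesgue differentiation -/

/-- Right difference quotients of the primitive are averages over `(x, y)`, and they converge to `g
x` almost everywhere. -/
theorem ae_le_maximalPlus {g : ℝ → ℝ≥0∞} (hg : AEMeasurable g volume) (hfin : ∫⁻ x, g x ≠ ∞) :
    ∀ᵐ x, g x ≤ maximalPlus g x := by
  have hint : Integrable (fun x => (g x).toReal) := integrable_toReal_of_lintegral_ne_top hg hfin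
  have hlt := ae_lt_top' hg hfin
  filter_upwards [LocallyIntegrable.ae_hasDerivAt_integral hint.locallyIntegrable, hlt] with x hx hxt
  refine le_of_forall_lt fun s hs => ?_
  have hst : s ≠ ∞ := hs.ne_top
  have hs' : s.toReal < (g x).toReal := (ENNReal.toReal_lt_toReal hst hxt.ne).2 hs
  rw [← ENNReal.ofReal_toReal hst, lt_maximalPlus_iff ENNReal.toReal_nonneg]
  have hslope := (hasDerivAt_iff_tendsto_slope.1 (hx x)).mono_left
    (nhdsWithin_mono x (show Ioi x ⊆ {x}ᶜ from fun y hy => ne_of_gt hy))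
  obtain ⟨y, hy, hxy⟩ := ((hslope.eventually (lt_mem_nhds hs')).and self_mem_nhdsWithin).exists
  refine ⟨y, hxy, ?_⟩
  have hxy' : 0 < y - x := sub_pos.2 hxy
  have hfin' : ∫⁻ z in Ioo x y, g z ≠ ∞ :=
    ne_top_of_le_ne_top hfin (setLIntegral_le_lintegral _ _)
  rw [slope_def_field, intervalIntegral.integral_same, sub_zero, lt_div_iff₀ hxy',
    intervalIntegral.integral_of_le (le_of_lt hxy),
    integral_toReal hg.restrict (ae_restrict_of_ae hlt)] at hy
  rw [ENNReal.ofReal_lt_iff_lt_toReal (by positivity) hfin',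
    setLIntegral_congr (Ioo_ae_eq_Ioc (μ := (volume : Measure ℝ)))]
  exact hy

/-! ### The reverse Hölder inequality -/

section

variable {σ : ℝ → ℝ≥0∞} {a c : ℝ}

theorem lintegral_maximalPlus_le_aInfty (h0 : ∫⁻ x in Ioo a c, σ x ≠ 0)
    (hfin : ∫⁻ x in Ioo a c, σ x ≠ ∞) :
    ∫⁻ x in Ioo a c, maximalPlus ((Ioo a c).indicator σ) x ≤
      aInftyMinusConst σ * ∫⁻ x in Ioo a c, σ x := by
  have hac : a < c := by
    by_contra h
    simp [Ioo_eq_empty_of_le (not_lt.1 h)] at h0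
  rw [← ENNReal.div_le_iff h0 hfin]
  exact le_iSup_of_le a (le_iSup_of_le c (le_iSup_of_le hac le_rfl))

theorem ae_le_maximalPlus_indicator (hσ : AEMeasurable σ volume)
    (hfin : ∫⁻ x in Ioo a c, σ x ≠ ∞) :
    ∀ᵐ x ∂volume.restrict (Ioo a c), σ x ≤ maximalPlus ((Ioo a c).indicator σ) x := by
  rw [ae_restrict_iff' measurableSet_Ioo]
  have h := ae_le_maximalPlus (hσ.indicator (measurableSet_Ioo (a := a) (b := c)))
    (by rwa [lintegral_indicator measurableSet_Ioo])
  filter_upwards [h] with x hx hxI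
  rwa [indicator_of_mem hxI] at hx

theorem one_le_aInftyMinusConst (hσ : AEMeasurable σ volume) (h0 : ∫⁻ x in Ioo a c, σ x ≠ 0)
    (hfin : ∫⁻ x in Ioo a c, σ x ≠ ∞) : 1 ≤ aInftyMinusConst σ := by
  have h1 := lintegral_maximalPlus_le_aInfty h0 hfin
  have h2 := lintegral_mono_ae (ae_le_maximalPlus_indicator hσ hfin)
  have h3 := h2.trans h1
  by_contra hlt
  refine absurd h3 (not_le.2 ?_)
  calc aInftyMinusConst σ * ∫⁻ x in Ioo a c, σ x < 1 * ∫⁻ x in Ioo a c, σ x :=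
        (ENNReal.mul_lt_mul_iff_left h0 hfin).2 (not_le.1 hlt)
    _ = _ := one_mul _

/-- On each component the mean of `σ` is at most `t`, so its mass is at most `t` times its length.
For a component starting at `a` this is where the bound on the maximal function at `a` enters. -/
theorem measure_levelSet_le_of_maximalPlus_le (hσ : AEMeasurable σ volume) {t : ℝ} (ht : 0 < t)
    (hfin : ∫⁻ x in Ioo a c, σ x ≠ ∞)
    (hta : maximalPlus ((Ioo a c).indicator σ) a ≤ ENNReal.ofReal t) {μ : Measure ℝ} {K : ℝ≥0∞}
    (h : ∀ α β, a ≤ α → α < β → β ≤ c → ∫⁻ x in Ioo α β, σ x ≠ 0 →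
      (∀ x ∈ Ioc α c, tilted σ t a x ≤ tilted σ t a β) →
      μ (Ioo α β) ≤ K * ∫⁻ x in Ioo α β, σ x) :
    μ (levelSet σ t a c) ≤ K * ENNReal.ofReal t * volume (levelSet σ t a c) := by
  rw [← risingSun_tilted ht.le hfin]
  have key : μ (risingSun (tilted σ t a) a c) ≤
      ((K * ENNReal.ofReal t) • volume) (risingSun (tilted σ t a) a c) := by
    refine measure_risingSun_le (continuousOn_tilted hσ hfin) ?_
    intro α β haα hαβ hβc _ hmax hαβ'
    have hle : tilted σ t a β ≤ tilted σ t a α := by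
      rcases hαβ' with rfl | h1
      · by_contra hlt
        refine absurd hta (not_le.2 ((mem_levelSet_iff ht.le ⟨le_rfl, hαβ.trans_le hβc⟩).1 ?_))
        exact ⟨β, ⟨hαβ, hβc⟩, (tilted_lt_iff ht.le hfin le_rfl hαβ.le hβc).1 (not_le.1 hlt)⟩
      · exact h1
    have hup : ∫⁻ x in Ioo α β, σ x ≤ ENNReal.ofReal (t * (β - α)) := by
      by_contra hlt
      exact absurd hle (not_le.2 ((tilted_lt_iff ht.le hfin haα hαβ.le hβc).2 (not_le.1 hlt)))
    have hpos : ∫⁻ x in Ioo α β, σ x ≠ 0 := by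
      intro h0
      have hm : (α + β) / 2 ∈ Ioc α c := ⟨by linarith, by linarith⟩
      have h1 := (tilted_le_iff hfin (haα.trans hm.1.le) (by linarith) hβc).1 (hmax _ hm)
      have h2 : ∫⁻ x in Ioo ((α + β) / 2) β, σ x ≤ 0 :=
        h0 ▸ lintegral_mono_set (Ioo_subset_Ioo_left hm.1.le)
      have h3 := h1.trans h2
      rw [nonpos_iff_eq_zero, ENNReal.ofReal_eq_zero] at h3
      nlinarith
    calc μ (Ioo α β) ≤ K * ∫⁻ x in Ioo α β, σ x := h α β haα hαβ hβc hpos hmax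
      _ ≤ K * ENNReal.ofReal (t * (β - α)) := by gcongr
      _ = _ := by
        rw [Measure.smul_apply, smul_eq_mul, Real.volume_Ioo, ENNReal.ofReal_mul ht.le, mul_assoc]
  simpa using key

/-- Averages reaching beyond `β` do not help: the mean of `σ` is at least `t` over `(x, β)` and at
most `t` over `(β, y)`. Hence on a component the maximal function is the one localized to that
component, to which the `A_∞⁻` condition applies. -/
theorem maximalPlus_indicator_le_of_tilted_le {t : ℝ}
    (hfin : ∫⁻ x in Ioo a c, σ x ≠ ∞) {α β x : ℝ} (haα : a ≤ α) (hβc : β ≤ c)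
    (hmax : ∀ x ∈ Ioc α c, tilted σ t a x ≤ tilted σ t a β) (hx : x ∈ Ioo α β) :
    maximalPlus ((Ioo a c).indicator σ) x ≤ maximalPlus ((Ioo α β).indicator σ) x := by
  refine le_of_forall_lt fun r hr => ?_
  by_contra hlt
  obtain ⟨s, hs1, hs2⟩ := ENNReal.lt_iff_exists_nnreal_btwn.1 ((not_lt.1 hlt).trans_lt hr)
  have hs : (s : ℝ≥0∞) = ENNReal.ofReal (s : ℝ) := (ENNReal.ofReal_coe_nnreal).symm
  rw [hs] at hs1 hs2
  obtain ⟨y, hy, hylt⟩ :=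
    (mem_levelSet_iff s.coe_nonneg ⟨haα.trans hx.1.le, hx.2.trans_le hβc⟩).2 hs2
  have hno := mt (mem_levelSet_iff s.coe_nonneg ⟨hx.1.le, hx.2⟩).1 (not_lt.2 hs1.le)
  have hax : a ≤ x := haα.trans hx.1.le
  have hβy : β < y := by
    by_contra hle
    exact hno ⟨y, ⟨hy.1, not_lt.1 hle⟩, hylt⟩
  have h1 : ¬ tilted σ s a x < tilted σ s a β := fun hh =>
    hno ⟨β, ⟨hx.2, le_rfl⟩, (tilted_lt_iff s.coe_nonneg hfin hax hx.2.le hβc).1 hh⟩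
  have h2 := (tilted_lt_iff s.coe_nonneg hfin hax hy.1.le hy.2).2 hylt
  have h3 := hmax x ⟨hx.1, hx.2.le.trans hβc⟩
  have h4 := hmax y ⟨hx.1.trans hy.1, hy.2⟩
  have hst : ∀ z, tilted σ s a z = tilted σ t a z - (s - t) * z := fun z => by
    simp only [tilted]; ring
  rw [hst x, hst β] at h1
  rw [hst x, hst y] at h2
  have h5 : (0 : ℝ) ≤ s - t := by
    by_contra hneg
    nlinarith [hx.2, not_lt.1 h1, not_le.1 hneg]
  nlinarith [not_lt.1 h1]

theorem setLIntegral_levelSet_maximalPlus_le (hσ : AEMeasurable σ volume) {t : ℝ} (ht : 0 < t)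
    (hfin : ∫⁻ x in Ioo a c, σ x ≠ ∞)
    (hta : maximalPlus ((Ioo a c).indicator σ) a ≤ ENNReal.ofReal t) :
    ∫⁻ x in levelSet σ t a c, maximalPlus ((Ioo a c).indicator σ) x ≤
      aInftyMinusConst σ * ENNReal.ofReal t * volume (levelSet σ t a c) := by
  have h := measure_levelSet_le_of_maximalPlus_le hσ ht hfin hta
    (μ := volume.withDensity (maximalPlus ((Ioo a c).indicator σ))) (K := aInftyMinusConst σ) ?_
  · rwa [withDensity_apply _ (measurableSet_levelSet σ ht.le)] at h
  · intro α β haα hαβ hβc h0 hmax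
    rw [withDensity_apply _ measurableSet_Ioo]
    refine le_trans (setLIntegral_mono' measurableSet_Ioo fun x hx =>
      maximalPlus_indicator_le_of_tilted_le hfin haα hβc hmax hx)
      (lintegral_maximalPlus_le_aInfty h0 ?_)
    exact ne_top_of_le_ne_top hfin (lintegral_mono_set (Ioo_subset_Ioo haα hβc))

theorem setLIntegral_levelSet_le (hσ : AEMeasurable σ volume) {t : ℝ} (ht : 0 < t)
    (hfin : ∫⁻ x in Ioo a c, σ x ≠ ∞)
    (hta : maximalPlus ((Ioo a c).indicator σ) a ≤ ENNReal.ofReal t) :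
    ∫⁻ x in levelSet σ t a c, σ x ≤ 1 * ENNReal.ofReal t * volume (levelSet σ t a c) := by
  have h := measure_levelSet_le_of_maximalPlus_le hσ ht hfin hta
    (μ := volume.withDensity σ) (K := 1) ?_
  · rwa [withDensity_apply _ (measurableSet_levelSet σ ht.le)] at h
  · intro α β haα hαβ hβc h0 hmax
    rw [withDensity_apply _ measurableSet_Ioo, one_mul]

theorem setLIntegral_le_maximalPlus_mul (hac : a < c) :
    ∫⁻ x in Ioo a c, σ x ≤
      maximalPlus ((Ioo a c).indicator σ) a * ENNReal.ofReal (c - a) := by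
  have hd0 : ENNReal.ofReal (c - a) ≠ 0 := by simpa using hac
  rw [← ENNReal.div_le_iff hd0 ENNReal.ofReal_ne_top]
  refine le_iSup_of_le (c - a) (le_iSup_of_le (sub_pos.2 hac) ?_)
  rw [add_sub_cancel]
  simp only [enorm_eq_self]
  rw [setLIntegral_indicator measurableSet_Ioo, inter_self]

/-- Two passes of the layer cake formula above the base level `G a`. With density `G` it gives `X ≤
K Y + K δ X`, and `K δ ≤ 1/2` lets `X` be absorbed, so `X ≤ 2 K Y`. With density `σ` it gives `Y + δ
X ≤ 2 Y`, and `K` disappears from the final constant. -/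
theorem setLIntegral_mul_min_rpow_le (hσ : AEMeasurable σ volume) (hac : a < c)
    (hfin : ∫⁻ x in Ioo a c, σ x ≠ ∞) (h0 : ∫⁻ x in Ioo a c, σ x ≠ 0)
    (hK : aInftyMinusConst σ ≠ ∞) {δ : ℝ} (hδ : 0 < δ)
    (hδK : aInftyMinusConst σ * ENNReal.ofReal δ ≤ 2⁻¹) (N : ℝ)
    (hat : maximalPlus ((Ioo a c).indicator σ) a ≠ ∞) :
    ∫⁻ x in Ioo a c, σ x * min (σ x) (ENNReal.ofReal N) ^ δ ≤
      2 * (maximalPlus ((Ioo a c).indicator σ) a ^ (1 + δ) * ENNReal.ofReal (c - a)) := by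
  set G := maximalPlus ((Ioo a c).indicator σ) with hG
  set K := aInftyMinusConst σ with hKdef
  have hGm : Measurable G := measurable_maximalPlus _
  have hl : ENNReal.ofReal (G a).toReal = G a := ENNReal.ofReal_toReal hat
  have hS := setLIntegral_le_maximalPlus_mul (σ := σ) hac
  have hGK : ∫⁻ x in Ioo a c, G x ≤ K * ∫⁻ x in Ioo a c, σ x :=
    lintegral_maximalPlus_le_aInfty h0 hfin
  have hGt : ∫⁻ x in Ioo a c, G x ≠ ∞ := ne_top_of_le_ne_top (ENNReal.mul_ne_top hK hfin) hGK
  have hmin : ∀ x, min (G x) (ENNReal.ofReal N) ^ δ ≤ ENNReal.ofReal N ^ δ := fun x => by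
    gcongr
    exact min_le_right _ _
  have hlev : ∀ t, 0 ≤ t → {x | ENNReal.ofReal t < G x} ∩ Ioo a c = levelSet σ t a c := by
    intro t ht
    rw [levelSet_eq σ ht, inter_comm]
    rfl
  have hset : ∀ t, MeasurableSet {x | ENNReal.ofReal t < G x} := fun t =>
    measurableSet_lt measurable_const hGm
  have hbase : ∀ (h : ℝ → ℝ≥0∞) (K' : ℝ≥0∞), K' ≠ ∞ → AEMeasurable h volume →
      (∀ t, 0 < t → G a ≤ ENNReal.ofReal t → ∫⁻ x in levelSet σ t a c, h x ≤
        K' * ENNReal.ofReal t * volume (levelSet σ t a c)) →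
      ∫⁻ x in Ioo a c, h x * min (G x) (ENNReal.ofReal N) ^ δ ≤
        G a ^ δ * (∫⁻ x in Ioo a c, h x) + K' * ENNReal.ofReal δ *
          ∫⁻ x in Ioo a c, min (G x) (ENNReal.ofReal N) ^ δ * G x := by
    intro h K' hK' hh hle
    have h1 := lintegral_min_rpow_le (ν := (volume.restrict (Ioo a c)).withDensity h)
      (m := volume.restrict (Ioo a c)) hGm hK' hδ (ENNReal.toReal_nonneg (a := G a)) N ?_
    · rw [lintegral_withDensity_eq_lintegral_mul₀ hh.restrict
        ((hGm.min measurable_const).pow_const _).aemeasurable,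
        withDensity_apply _ MeasurableSet.univ, Measure.restrict_univ, hl] at h1
      exact h1
    · intro t ht
      have ht0 : 0 < t := ENNReal.toReal_nonneg.trans_lt ht
      rw [withDensity_apply _ (hset t), Measure.restrict_restrict (hset t),
        Measure.restrict_apply (hset t), hlev t ht0.le]
      refine hle t ht0 ?_
      rw [← hl]
      exact ENNReal.ofReal_le_ofReal ht.le
  set X := ∫⁻ x in Ioo a c, min (G x) (ENNReal.ofReal N) ^ δ * G x with hX
  -- Finiteness, secured by the truncation at `N`, is what permits the absorption.
  have hXt : X ≠ ∞ := by
    refine ne_top_of_le_ne_top (ENNReal.mul_ne_top (ENNReal.rpow_ne_top_of_nonneg hδ.le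
      (ENNReal.ofReal_ne_top (r := N))) hGt) ?_
    rw [← lintegral_const_mul' _ _ (ENNReal.rpow_ne_top_of_nonneg hδ.le ENNReal.ofReal_ne_top)]
    exact lintegral_mono fun x => mul_le_mul_left (hmin x) _
  have hsplit : G a ^ (1 + δ) = G a * G a ^ δ := by
    rw [ENNReal.rpow_add_of_nonneg _ _ zero_le_one hδ.le, ENNReal.rpow_one]
  set Y := G a ^ (1 + δ) * ENNReal.ofReal (c - a) with hY
  have hσY : G a ^ δ * ∫⁻ x in Ioo a c, σ x ≤ Y := by
    calc G a ^ δ * ∫⁻ x in Ioo a c, σ x ≤ G a ^ δ * (G a * ENNReal.ofReal (c - a)) := by gcongr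
      _ = Y := by rw [hY, hsplit]; ring
  have hXY : X ≤ 2 * (K * Y) := by
    have h1 := hbase G K hK hGm.aemeasurable fun t ht hta =>
      setLIntegral_levelSet_maximalPlus_le hσ ht hfin hta
    simp only [mul_comm (G _)] at h1
    rw [← hX] at h1
    have h2 : X ≤ K * Y + 2⁻¹ * X := by
      refine h1.trans (add_le_add ?_ (by gcongr))
      calc G a ^ δ * (∫⁻ x in Ioo a c, G x) ≤ G a ^ δ * (K * ∫⁻ x in Ioo a c, σ x) := by gcongr
        _ = K * (G a ^ δ * ∫⁻ x in Ioo a c, σ x) := by ring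
        _ ≤ K * Y := by gcongr
    have h3 : 2⁻¹ * X + 2⁻¹ * X ≤ K * Y + 2⁻¹ * X := by
      rwa [← add_mul, ENNReal.inv_two_add_inv_two, one_mul]
    have h4 := (ENNReal.add_le_add_iff_right
      (ENNReal.mul_ne_top (ENNReal.inv_ne_top.2 two_ne_zero) hXt)).1 h3
    calc X = 2 * (2⁻¹ * X) := by
          rw [← mul_assoc, ENNReal.mul_inv_cancel two_ne_zero ENNReal.ofNat_ne_top, one_mul]
      _ ≤ _ := by gcongr
  -- For `σ` itself the level set constant is `1` instead of `K`.
  have h1 := hbase σ 1 ENNReal.one_ne_top hσ fun t ht hta =>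
    setLIntegral_levelSet_le hσ ht hfin hta
  calc ∫⁻ x in Ioo a c, σ x * min (σ x) (ENNReal.ofReal N) ^ δ
      ≤ ∫⁻ x in Ioo a c, σ x * min (G x) (ENNReal.ofReal N) ^ δ := by
        refine lintegral_mono_ae ?_
        filter_upwards [ae_le_maximalPlus_indicator hσ hfin] with x hx
        gcongr
    _ ≤ Y + 1 * ENNReal.ofReal δ * (2 * (K * Y)) := by
        refine h1.trans (add_le_add hσY ?_)
        gcongr
    _ = Y + 2 * (K * ENNReal.ofReal δ) * Y := by ring
    _ ≤ Y + 2 * 2⁻¹ * Y := by gcongr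
    _ = 2 * Y := by
        rw [ENNReal.mul_inv_cancel two_ne_zero ENNReal.ofNat_ne_top, one_mul, two_mul]

/-- The weak reverse Hölder inequality for one-sided `A_∞` weights. -/
theorem setLIntegral_rpow_le_maximalPlus (hσ : AEMeasurable σ volume) (hac : a < c)
    (hfin : ∫⁻ x in Ioo a c, σ x ≠ ∞) (h0 : ∫⁻ x in Ioo a c, σ x ≠ 0)
    (hK : aInftyMinusConst σ ≠ ∞) {δ : ℝ} (hδ : 0 < δ)
    (hδK : aInftyMinusConst σ * ENNReal.ofReal δ ≤ 2⁻¹) :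
    ∫⁻ x in Ioo a c, σ x ^ (1 + δ) ≤
      2 * (maximalPlus ((Ioo a c).indicator σ) a ^ (1 + δ) * ENNReal.ofReal (c - a)) := by
  rcases eq_or_ne (maximalPlus ((Ioo a c).indicator σ) a) ∞ with hat | hat
  · rw [hat, ENNReal.top_rpow_of_pos (by linarith), ENNReal.top_mul (by simpa using hac)]
    simp
  have hlim : Tendsto (fun n : ℕ => ∫⁻ x in Ioo a c, σ x * min (σ x) (ENNReal.ofReal n) ^ δ) atTop
      (𝓝 (∫⁻ x in Ioo a c, σ x ^ (1 + δ))) := by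
    refine lintegral_tendsto_of_tendsto_of_monotone (fun n => ?_) ?_ ?_
    · exact hσ.restrict.mul ((hσ.restrict.min aemeasurable_const).pow_const _)
    · refine Eventually.of_forall fun x m n hmn => ?_
      have : (m : ℝ) ≤ n := by exact_mod_cast hmn
      dsimp only
      gcongr
    · filter_upwards [ae_lt_top' hσ.restrict hfin] with x hx
      refine tendsto_const_nhds.congr' ?_
      obtain ⟨n, hn⟩ := ENNReal.exists_nat_gt hx.ne
      filter_upwards [eventually_ge_atTop n] with m hm
      have hle : σ x ≤ ENNReal.ofReal m := by
        rw [ENNReal.ofReal_natCast]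
        exact hn.le.trans (by exact_mod_cast hm)
      rw [min_eq_left hle, ENNReal.rpow_add_of_nonneg _ _ zero_le_one hδ.le, ENNReal.rpow_one]
  exact le_of_tendsto' hlim fun n =>
    setLIntegral_mul_min_rpow_le hσ hac hfin h0 hK hδ hδK n hat

end

section

variable {p : ℝ} {w : ℝ → ℝ≥0∞}

/-! ### Finiteness of the one-sided `A_∞` constant -/

/-- The mean of `w` over the level set is at most a multiple of `t^{1-p}`. By Chebyshev's inequality
`w` is below twice that bound on at least half of the set, and there the dual weight exceeds a
multiple of `t`. -/
theorem volume_levelSet_dual_le (hp : 1 < p) (hw : AEMeasurable w volume)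
    (hA : apPlusConst p w ≠ ∞) {a c t : ℝ} (ht : 0 < t)
    (hfin : ∫⁻ x in Ioo a c, w x ^ (-1 / (p - 1)) ≠ ∞) :
    volume (levelSet (fun x => w x ^ (-1 / (p - 1))) t a c) ≤
      2 * (volume.restrict (Ioo a c)) {x | ENNReal.ofReal t <
        (2 * (2 * 4 ^ (p - 1) * apPlusConst p w + 1)) ^ (1 / (p - 1)) *
          w x ^ (-1 / (p - 1))} := by
  have hp1 : 0 < p - 1 := by linarith
  set σ : ℝ → ℝ≥0∞ := fun x => w x ^ (-1 / (p - 1)) with hσ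
  set O := levelSet σ t a c with hO
  -- The added `1` keeps `B` nonzero, so that it can be cancelled.
  set B := 2 * 4 ^ (p - 1) * apPlusConst p w + 1 with hB
  set T := ENNReal.ofReal t ^ (p - 1) with hT
  have hT0 : T ≠ 0 := by simp [hT, ht]
  have hTt : T ≠ ∞ := ENNReal.rpow_ne_top_of_nonneg hp1.le ENNReal.ofReal_ne_top
  have hBt : B ≠ ∞ := by
    refine ENNReal.add_ne_top.2 ⟨ENNReal.mul_ne_top (ENNReal.mul_ne_top ENNReal.ofNat_ne_top ?_) hA,
      ENNReal.one_ne_top⟩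
    exact ENNReal.rpow_ne_top_of_nonneg hp1.le ENNReal.ofNat_ne_top
  have hB0 : B ≠ 0 := by simp [hB]
  have hOm : MeasurableSet O := measurableSet_levelSet σ ht.le
  have hOt : volume O ≠ ∞ := by
    refine ne_top_of_le_ne_top ?_ (measure_mono (levelSet_subset σ t a c))
    simp
  have h1 : T * (volume.withDensity w) O ≤ B * volume O := by
    refine (weight_levelSet_dual_le hp hw ht hfin).trans ?_
    gcongr
    exact le_self_add
  set E := {x | 2 * B / T ≤ w x} with hE
  have h2 : 2 * B / T * (volume.restrict O) E ≤ (volume.withDensity w) O := by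
    rw [withDensity_apply _ hOm]
    exact mul_meas_ge_le_lintegral₀ hw.restrict _
  have h3 : 2 * (volume.restrict O) E ≤ volume O := by
    rw [← ENNReal.mul_le_mul_iff_right hB0 hBt]
    calc B * (2 * (volume.restrict O) E) = T * (2 * B / T * (volume.restrict O) E) := by
          rw [← mul_assoc, ← mul_assoc, ENNReal.mul_div_cancel hT0 hTt]
          ring
      _ ≤ T * (volume.withDensity w) O := by gcongr
      _ ≤ _ := h1
  have hsub : (univ : Set ℝ) ⊆ E ∪ {x | ENNReal.ofReal t < (2 * B) ^ (1 / (p - 1)) * σ x} := by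
    intro x _
    by_cases hx : ENNReal.ofReal t < (2 * B) ^ (1 / (p - 1)) * σ x
    · exact Or.inr hx
    · refine Or.inl ?_
      have h4 := ENNReal.rpow_le_rpow (not_lt.1 hx) hp1.le
      rw [ENNReal.mul_rpow_of_nonneg _ _ hp1.le, ← ENNReal.rpow_mul, hσ] at h4
      simp only at h4
      rw [← ENNReal.rpow_mul, div_mul_cancel₀ _ hp1.ne', div_mul_cancel₀ _ hp1.ne',
        ENNReal.rpow_one, ENNReal.rpow_neg_one] at h4
      show 2 * B / T ≤ w x
      rw [ENNReal.div_le_iff_le_mul (Or.inl hT0) (Or.inl hTt), mul_comm (w x)]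
      exact (ENNReal.div_le_iff_le_mul (Or.inr hTt) (Or.inr hT0)).1 h4
  set F := {x | ENNReal.ofReal t < (2 * B) ^ (1 / (p - 1)) * σ x} with hF
  have h5 : volume O ≤ (volume.restrict O) E + (volume.restrict O) F := by
    calc volume O = (volume.restrict O) univ := by simp
      _ ≤ _ := (measure_mono hsub).trans (measure_union_le _ _)
  have h6 : volume O + volume O ≤ volume O + 2 * (volume.restrict O) F := by
    calc volume O + volume O = 2 * volume O := (two_mul _).symm
      _ ≤ 2 * ((volume.restrict O) E + (volume.restrict O) F) := by gcongr
      _ = 2 * (volume.restrict O) E + 2 * (volume.restrict O) F := mul_add _ _ _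
      _ ≤ _ := by gcongr
  refine ((ENNReal.add_le_add_iff_left hOt).1 h6).trans ?_
  gcongr
  exact levelSet_subset σ t a c

/-- Integrating the previous estimate over all heights `t`. Only finiteness is retained: it makes a
positive `δ` available in the reverse Hölder inequality. -/
theorem aInftyMinusConst_dual_ne_top (hp : 1 < p) (hw : AEMeasurable w volume)
    (hwt : ∀ x, w x ≠ ∞) (hA : apPlusConst p w ≠ ∞) :
    aInftyMinusConst (fun x => w x ^ (-1 / (p - 1))) ≠ ∞ := by
  have hp1 : 0 < p - 1 := by linarith
  set D := (2 * (2 * 4 ^ (p - 1) * apPlusConst p w + 1)) ^ (1 / (p - 1)) with hD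
  have hDt : D ≠ ∞ := by
    refine ENNReal.rpow_ne_top_of_nonneg (by positivity) (ENNReal.mul_ne_top ENNReal.ofNat_ne_top
      (ENNReal.add_ne_top.2 ⟨ENNReal.mul_ne_top (ENNReal.mul_ne_top ENNReal.ofNat_ne_top ?_) hA,
      ENNReal.one_ne_top⟩))
    exact ENNReal.rpow_ne_top_of_nonneg hp1.le ENNReal.ofNat_ne_top
  refine ne_top_of_le_ne_top (ENNReal.mul_ne_top (ENNReal.ofNat_ne_top (n := 2)) hDt) ?_
  refine iSup_le fun a => iSup_le fun c => iSup_le fun hac => ?_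
  set σ : ℝ → ℝ≥0∞ := fun x => w x ^ (-1 / (p - 1)) with hσ
  rcases eq_or_ne (∫⁻ x in Ioo a c, σ x) ∞ with hfin | hfin
  · rw [hfin, ENNReal.div_top]
    exact zero_le
  rw [ENNReal.div_le_iff (dual_ne_zero hp hw hwt hac) hfin]
  set G := maximalPlus ((Ioo a c).indicator σ) with hG
  have hGm : Measurable G := measurable_maximalPlus _
  calc ∫⁻ x in Ioo a c, G x
      = ∫⁻ t in Ioi (0 : ℝ), (volume.restrict (Ioo a c)) {x | ENNReal.ofReal t < G x} :=
        lintegral_eq_lintegral_meas_ofReal_lt _ hGm.aemeasurable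
    _ ≤ ∫⁻ t in Ioi (0 : ℝ), 2 * (volume.restrict (Ioo a c)) {x | ENNReal.ofReal t < D * σ x} := by
        refine setLIntegral_mono' measurableSet_Ioi fun t ht => ?_
        refine le_trans (le_of_eq ?_) (volume_levelSet_dual_le hp hw hA ht hfin)
        rw [Measure.restrict_apply (measurableSet_lt measurable_const hGm),
          levelSet_eq σ (le_of_lt ht), inter_comm]
        rfl
    _ = 2 * ∫⁻ x in Ioo a c, D * σ x := by
        rw [lintegral_const_mul' _ _ ENNReal.ofNat_ne_top,
          ← lintegral_eq_lintegral_meas_ofReal_lt _ ((aemeasurable_dual hw).restrict.const_mul D)]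
    _ = 2 * D * ∫⁻ x in Ioo a c, σ x := by
        rw [lintegral_const_mul' _ _ hDt, mul_assoc]

/-! ### Self-improvement of the one-sided `A_p` condition -/

/-- For each `x` left of `b`, reverse Hölder on `(x, c)` shows that half the `L^{1+δ}` mean in the
hypothesis is at most the maximal function of `σ` at `x`. Thus `x` lies in the level set at height
`t`, and the `w`-measure of level sets is already known. -/
theorem weight_mul_dual_rpow_le (hp : 1 < p) (hw : AEMeasurable w volume) (hwt : ∀ x, w x ≠ ∞)
    (hA : apPlusConst p w ≠ ∞) {δ : ℝ} (hδ : 0 < δ)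
    (hδK : aInftyMinusConst (fun x => w x ^ (-1 / (p - 1))) * ENNReal.ofReal δ ≤ 2⁻¹)
    {a b c t : ℝ} (hab : a < b) (hbc : b < c) (ht : 0 < t)
    (hlt : ENNReal.ofReal t < ((∫⁻ x in Ioo b c, (w x ^ (-1 / (p - 1))) ^ (1 + δ)) /
      ENNReal.ofReal (c - a)) ^ (1 / (1 + δ)) / 2) :
    (∫⁻ x in Ioo a b, w x) * ENNReal.ofReal t ^ (p - 1) ≤
      2 * 4 ^ (p - 1) * apPlusConst p w * ENNReal.ofReal (c - a) := by
  have hp1 : 0 < p - 1 := by linarith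
  have hδ1 : 0 < 1 + δ := by linarith
  set σ : ℝ → ℝ≥0∞ := fun x => w x ^ (-1 / (p - 1)) with hσ
  have hK : aInftyMinusConst σ ≠ ∞ := aInftyMinusConst_dual_ne_top hp hw hwt hA
  have hσm : AEMeasurable σ volume := aemeasurable_dual hw
  set T := ENNReal.ofReal t ^ (p - 1) with hT
  have hT0 : T ≠ 0 := by simp [hT, ht]
  have hTt : T ≠ ∞ := ENNReal.rpow_ne_top_of_nonneg hp1.le ENNReal.ofReal_ne_top
  have hd0 : ENNReal.ofReal (c - a) ≠ 0 := by simp; linarith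
  rw [← ENNReal.le_div_iff_mul_le (Or.inl hT0) (Or.inl hTt),
    ← withDensity_apply _ measurableSet_Ioo]
  refine weight_le_of_forall_rightSupport fun a' ha' => ?_
  rw [ENNReal.le_div_iff_mul_le (Or.inl hT0) (Or.inl hTt), Ioo_inter_Ioi, mul_comm]
  -- Moving the left end to `e` ensures that `σ` is integrable on `(e, c)`.
  set e := max a a' with he
  have hfin : ∫⁻ x in Ioo e c, σ x ≠ ∞ := dual_ne_top_of_mem_rightSupport hp hA
    (mem_rightSupport_of_le ha' (le_max_right _ _)) c
  have hsub : Ioo e b ⊆ levelSet σ t e c := by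
    intro x hx
    have hxc : x < c := hx.2.trans hbc
    have hax : a ≤ x := (le_max_left a a').trans hx.1.le
    refine ⟨⟨hx.1, hxc⟩, (mem_levelSet_iff ht.le ⟨le_rfl, hxc⟩).2 (hlt.trans_le ?_)⟩
    have h1 := setLIntegral_rpow_le_maximalPlus hσm hxc
      (ne_top_of_le_ne_top hfin (lintegral_mono_set (Ioo_subset_Ioo_left hx.1.le)))
      (dual_ne_zero hp hw hwt hxc) hK hδ hδK
    set M := maximalPlus ((Ioo x c).indicator σ) x
    have h2 : (∫⁻ x in Ioo b c, σ x ^ (1 + δ)) / ENNReal.ofReal (c - a) ≤ (2 * M) ^ (1 + δ) := by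
      rw [ENNReal.div_le_iff hd0 ENNReal.ofReal_ne_top]
      calc ∫⁻ x in Ioo b c, σ x ^ (1 + δ) ≤ ∫⁻ x in Ioo x c, σ x ^ (1 + δ) :=
            lintegral_mono_set (Ioo_subset_Ioo_left hx.2.le)
        _ ≤ 2 * (M ^ (1 + δ) * ENNReal.ofReal (c - x)) := h1
        _ ≤ 2 ^ (1 + δ) * (M ^ (1 + δ) * ENNReal.ofReal (c - a)) := by
            gcongr
            conv_lhs => rw [← ENNReal.rpow_one 2]
            exact ENNReal.rpow_le_rpow_of_exponent_le (by norm_num) (by linarith)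
        _ = (2 * M) ^ (1 + δ) * ENNReal.ofReal (c - a) := by
            rw [ENNReal.mul_rpow_of_nonneg _ _ hδ1.le, mul_assoc]
    refine ENNReal.div_le_of_le_mul ?_
    rw [mul_comm, one_div]
    exact (ENNReal.rpow_inv_le_iff hδ1).2 h2
  calc T * (volume.withDensity w) (Ioo e b) ≤ T * (volume.withDensity w) (levelSet σ t e c) := by
        gcongr
    _ ≤ 2 * 4 ^ (p - 1) * apPlusConst p w * volume (levelSet σ t e c) :=
        weight_levelSet_dual_le hp hw ht hfin
    _ ≤ _ := by
        gcongr
        refine (measure_mono (levelSet_subset σ t e c)).trans ?_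
        rw [Real.volume_Ioo]
        gcongr
        exact le_max_left _ _

/-- The exponent is chosen so that its dual weight is `σ^{1+δ}`. The previous bound is used at all
heights below `S / 2`; this halving turns `4^{p-1}` into `8^{p-1}`. -/
theorem apPlusConst_self_improve (hp : 1 < p) (hw : AEMeasurable w volume) (hwt : ∀ x, w x ≠ ∞)
    (hloc : ∀ a b, ∫⁻ x in Ioo a b, w x ≠ ∞)
    (hA : apPlusConst p w ≠ ∞) {δ : ℝ} (hδ : 0 < δ)
    (hδK : aInftyMinusConst (fun x => w x ^ (-1 / (p - 1))) * ENNReal.ofReal δ ≤ 2⁻¹) :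
    apPlusConst (1 + (p - 1) / (1 + δ)) w ≤ 2 * 8 ^ (p - 1) * apPlusConst p w := by
  have hp1 : 0 < p - 1 := by linarith
  have hδ1 : 0 < 1 + δ := by linarith
  refine iSup_le fun a => iSup_le fun b => iSup_le fun c => iSup_le fun hab => iSup_le fun hbc => ?_
  have hd0 : ENNReal.ofReal (c - a) ≠ 0 := by simp; linarith
  have hdt : ENNReal.ofReal (c - a) ≠ ∞ := ENNReal.ofReal_ne_top
  rw [add_sub_cancel_left]
  have hexp : ∀ x, w x ^ (-1 / ((p - 1) / (1 + δ))) = (w x ^ (-1 / (p - 1))) ^ (1 + δ) := by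
    intro x
    rw [← ENNReal.rpow_mul]
    congr 1
    field_simp
  simp only [hexp]
  set Q := (∫⁻ x in Ioo b c, (w x ^ (-1 / (p - 1))) ^ (1 + δ)) / ENNReal.ofReal (c - a) with hQ
  set S := Q ^ (1 / (1 + δ)) with hS
  have hQS : Q ^ ((p - 1) / (1 + δ)) = S ^ (p - 1) := by
    rw [hS, ← ENNReal.rpow_mul]
    congr 1
    field_simp
  rw [hQS]
  set W := ∫⁻ x in Ioo a b, w x with hW
  set D := 2 * 4 ^ (p - 1) * apPlusConst p w * ENNReal.ofReal (c - a) with hD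
  rcases eq_or_ne W 0 with hW0 | hW0
  · simp [hW0]
  have hle : S / 2 ≤ (D / W) ^ (1 / (p - 1)) := by
    refine le_of_forall_lt_imp_le_of_dense fun s hs => ?_
    have hst : s ≠ ∞ := hs.ne_top
    rcases eq_or_ne s 0 with rfl | hs0
    · exact zero_le
    rw [← ENNReal.ofReal_toReal hst] at hs ⊢
    rw [one_div, ENNReal.le_rpow_inv_iff hp1,
      ENNReal.le_div_iff_mul_le (Or.inl hW0) (Or.inl (hloc a b)), mul_comm]
    exact weight_mul_dual_rpow_le hp hw hwt hA hδ hδK hab hbc (ENNReal.toReal_pos hs0 hst) hs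
  rw [one_div, ENNReal.le_rpow_inv_iff hp1,
    ENNReal.le_div_iff_mul_le (Or.inl hW0) (Or.inl (hloc a b))] at hle
  have h8 : (8 : ℝ≥0∞) ^ (p - 1) = 2 ^ (p - 1) * 4 ^ (p - 1) := by
    rw [← ENNReal.mul_rpow_of_nonneg _ _ hp1.le]
    norm_num
  have hS2 : S ^ (p - 1) = 2 ^ (p - 1) * (S / 2) ^ (p - 1) := by
    rw [← ENNReal.mul_rpow_of_nonneg _ _ hp1.le, ENNReal.mul_div_cancel two_ne_zero
      ENNReal.ofNat_ne_top]
  calc W / ENNReal.ofReal (c - a) * S ^ (p - 1)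
      = 2 ^ (p - 1) * ((S / 2) ^ (p - 1) * W) / ENNReal.ofReal (c - a) := by
        rw [hS2]
        simp only [div_eq_mul_inv]
        ring
    _ ≤ 2 ^ (p - 1) * D / ENNReal.ofReal (c - a) := by gcongr
    _ = 2 * 8 ^ (p - 1) * apPlusConst p w * (ENNReal.ofReal (c - a) / ENNReal.ofReal (c - a)) := by
        rw [hD, h8]
        simp only [div_eq_mul_inv]
        ring
    _ = _ := by rw [ENNReal.div_self hd0 hdt, mul_one]

end

/-! ### Dyadic sums in Lorentz quasi-norms -/

theorem rpow_tsum_le_tsum_rpow {ι : Type*} (f : ι → ℝ≥0∞) {θ : ℝ} (h0 : 0 < θ) (h1 : θ ≤ 1) :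
    (∑' i, f i) ^ θ ≤ ∑' i, f i ^ θ := by
  have hfin : ∀ s : Finset ι, (∑ i ∈ s, f i) ^ θ ≤ ∑ i ∈ s, f i ^ θ := by
    classical
    intro s
    induction s using Finset.induction_on with
    | empty => simp [ENNReal.zero_rpow_of_pos h0]
    | insert i s hi ih =>
      rw [Finset.sum_insert hi, Finset.sum_insert hi]
      exact (ENNReal.rpow_add_le_add_rpow _ _ h0.le h1).trans (by gcongr)
  rw [← ENNReal.le_rpow_inv_iff h0, ENNReal.tsum_eq_iSup_sum]
  refine iSup_le fun s => ?_
  rw [ENNReal.le_rpow_inv_iff h0]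
  exact (hfin s).trans (ENNReal.sum_le_tsum s)

/-- Convexity of `x ↦ x^θ` with unnormalized weights `c`. -/
theorem rpow_tsum_mul_le {ι : Type*} (c b : ι → ℝ≥0∞) {θ : ℝ} (h1 : 1 ≤ θ) :
    (∑' i, c i * b i) ^ θ ≤ (∑' i, c i) ^ (θ - 1) * ∑' i, c i * b i ^ θ := by
  have h0 : 0 < θ := by linarith
  have hinv : 0 ≤ 1 - θ⁻¹ := sub_nonneg.2 (inv_le_one_of_one_le₀ h1)
  have hle : ∑' i, c i * b i ≤ (∑' i, c i) ^ (1 - θ⁻¹) * (∑' i, c i * b i ^ θ) ^ θ⁻¹ := by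
    rw [ENNReal.tsum_eq_iSup_sum]
    refine iSup_le fun s => (ENNReal.inner_le_weight_mul_Lp_of_nonneg s h1 c b).trans ?_
    gcongr <;> exact ENNReal.sum_le_tsum s
  refine (ENNReal.rpow_le_rpow hle h0.le).trans_eq ?_
  rw [ENNReal.mul_rpow_of_nonneg _ _ h0.le, ← ENNReal.rpow_mul, ← ENNReal.rpow_mul,
    inv_mul_cancel₀ h0.ne', ENNReal.rpow_one, sub_mul, inv_mul_cancel₀ h0.ne', one_mul]

theorem setLIntegral_Ioi_comp_mul_left (F : ℝ → ℝ≥0∞) {c : ℝ} (hc : 0 < c) :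
    ENNReal.ofReal c * ∫⁻ t in Ioi (0 : ℝ), F (c * t) = ∫⁻ t in Ioi (0 : ℝ), F t := by
  have hm := Real.smul_map_volume_mul_left hc.ne'
  have h1 : ∫⁻ t in Ioi (0 : ℝ), F t = ∫⁻ t, (Ioi (0 : ℝ)).indicator F t :=
    (lintegral_indicator measurableSet_Ioi F).symm
  have h2 : ∫⁻ t in Ioi (0 : ℝ), F (c * t) = ∫⁻ t, (Ioi (0 : ℝ)).indicator F (c * t) := by
    rw [← lintegral_indicator measurableSet_Ioi]
    refine lintegral_congr fun t => ?_
    simp only [indicator_apply, mem_Ioi, mul_pos_iff_of_pos_left hc]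
  have h3 : ∫⁻ t, (Ioi (0 : ℝ)).indicator F t ∂(Measure.map (c * ·) volume) =
      ∫⁻ t, (Ioi (0 : ℝ)).indicator F (c * t) :=
    lintegral_map_equiv _ (Homeomorph.mulLeft₀ c hc.ne').toMeasurableEquiv
  rw [h1, h2, ← h3]
  conv_rhs => rw [← hm]
  rw [lintegral_smul_measure, abs_of_pos hc, smul_eq_mul]

section

variable {p q : ℝ} {N Φ : ℝ → ℝ≥0∞}

theorem lorentz_integrand_eq (hq : 0 ≤ q) (t : ℝ) (n : ℝ≥0∞) :
    (ENNReal.ofReal t * n ^ (1 / p)) ^ q / ENNReal.ofReal t =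
      ENNReal.ofReal t ^ q / ENNReal.ofReal t * n ^ (q / p) := by
  rw [ENNReal.mul_rpow_of_nonneg _ _ hq, ← ENNReal.rpow_mul, div_mul_eq_mul_div, one_mul]
  simp only [div_eq_mul_inv]
  ring

theorem lorentz_integral_comp_mul (hq : 0 ≤ q) {c : ℝ} (hc : 0 < c) :
    ∫⁻ t in Ioi (0 : ℝ), (ENNReal.ofReal t * N (c * t) ^ (1 / p)) ^ q / ENNReal.ofReal t =
      ENNReal.ofReal c ^ (-q) *
        ∫⁻ t in Ioi (0 : ℝ), (ENNReal.ofReal t * N t ^ (1 / p)) ^ q / ENNReal.ofReal t := by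
  set F : ℝ → ℝ≥0∞ := fun t => (ENNReal.ofReal t * N t ^ (1 / p)) ^ q / ENNReal.ofReal t with hF
  have hc0 : ENNReal.ofReal c ≠ 0 := by simpa using hc
  have hct : ENNReal.ofReal c ≠ ∞ := ENNReal.ofReal_ne_top
  have hcq : ENNReal.ofReal c ^ (-q) * ENNReal.ofReal c ≠ ∞ :=
    ENNReal.mul_ne_top (ENNReal.rpow_ne_top_of_ne_zero hc0 hct) hct
  rw [← setLIntegral_Ioi_comp_mul_left F hc, ← mul_assoc, ← lintegral_const_mul' _ _ hcq]
  refine setLIntegral_congr_fun measurableSet_Ioi fun t ht => ?_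
  have ht0 : ENNReal.ofReal t ≠ 0 := by simpa using ht
  have h1 : ENNReal.ofReal c ^ (-q) * ENNReal.ofReal c ^ q = 1 := by
    rw [← ENNReal.rpow_add _ _ hc0 hct, neg_add_cancel, ENNReal.rpow_zero]
  simp only [hF]
  rw [lorentz_integrand_eq hq, lorentz_integrand_eq hq, ENNReal.ofReal_mul hc.le,
    ENNReal.mul_rpow_of_nonneg _ _ hq]
  simp only [div_eq_mul_inv]
  rw [ENNReal.mul_inv (Or.inl hc0) (Or.inl hct)]
  calc ENNReal.ofReal t ^ q * (ENNReal.ofReal t)⁻¹ * N (c * t) ^ (q * p⁻¹)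
      = (ENNReal.ofReal c ^ (-q) * ENNReal.ofReal c ^ q) *
        (ENNReal.ofReal c * (ENNReal.ofReal c)⁻¹) *
          (ENNReal.ofReal t ^ q * (ENNReal.ofReal t)⁻¹ * N (c * t) ^ (q * p⁻¹)) := by
        rw [h1, ENNReal.mul_inv_cancel hc0 hct, one_mul, one_mul]
    _ = _ := by ring

theorem ofReal_two_pow_div_two_rpow_neg (k : ℕ) (q : ℝ) :
    ENNReal.ofReal (2 ^ k / 2) ^ (-q) = 2 ^ q * 2 ^ (-(k * q) : ℝ) := by
  have h2 : (2 : ℝ≥0∞) ≠ 0 := two_ne_zero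
  rw [ENNReal.ofReal_div_of_pos two_pos, ENNReal.ofReal_pow two_pos.le, ENNReal.ofReal_ofNat,
    ← ENNReal.rpow_natCast, div_eq_mul_inv, ← ENNReal.rpow_neg_one,
    ← ENNReal.rpow_add _ _ h2 ENNReal.ofNat_ne_top, ← ENNReal.rpow_mul,
    ← ENNReal.rpow_add _ _ h2 ENNReal.ofNat_ne_top]
  congr 1
  ring

/-- By invariance of `dt / t` under dilations, the `k`-th term contributes the integral for `N`
times `(2^{k-1})^{-q}`. -/
theorem lorentz_integral_le_tsum (hq : 0 ≤ q) (hN : Antitone N) {A : ℝ≥0∞} (hA : A ≠ ∞)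
    {e : ℕ → ℝ≥0∞}
    (h : ∀ t, 0 < t → Φ t ^ (q / p) ≤ A * ∑' k, e k * N (2 ^ k / 2 * t) ^ (q / p)) :
    ∫⁻ t in Ioi (0 : ℝ), (ENNReal.ofReal t * Φ t ^ (1 / p)) ^ q / ENNReal.ofReal t ≤
      A * (2 ^ q * ∑' k : ℕ, e k * 2 ^ (-(k * q) : ℝ)) *
        ∫⁻ t in Ioi (0 : ℝ), (ENNReal.ofReal t * N t ^ (1 / p)) ^ q / ENNReal.ofReal t := by
  set J := ∫⁻ t in Ioi (0 : ℝ), (ENNReal.ofReal t * N t ^ (1 / p)) ^ q / ENNReal.ofReal t with hJ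
  have hmeas : ∀ k : ℕ, Measurable fun t : ℝ =>
      (ENNReal.ofReal t * N (2 ^ k / 2 * t) ^ (1 / p)) ^ q / ENNReal.ofReal t := by
    intro k
    have := hN.measurable
    fun_prop
  calc ∫⁻ t in Ioi (0 : ℝ), (ENNReal.ofReal t * Φ t ^ (1 / p)) ^ q / ENNReal.ofReal t
      ≤ ∫⁻ t in Ioi (0 : ℝ), A * ∑' k : ℕ, e k *
          ((ENNReal.ofReal t * N (2 ^ k / 2 * t) ^ (1 / p)) ^ q / ENNReal.ofReal t) := by
        refine setLIntegral_mono' measurableSet_Ioi fun t ht => ?_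
        simp only [lorentz_integrand_eq hq]
        refine (mul_le_mul_right (h t ht) _).trans_eq ?_
        rw [mul_left_comm, ← ENNReal.tsum_mul_left]
        congr 2
        ext k
        ring
    _ = A * ∑' k : ℕ, e k * (ENNReal.ofReal (2 ^ k / 2) ^ (-q) * J) := by
        rw [lintegral_const_mul' _ _ hA, lintegral_tsum fun k =>
          ((hmeas k).const_mul (e k)).aemeasurable]
        congr 2
        ext k
        rw [lintegral_const_mul _ (hmeas k), lorentz_integral_comp_mul hq (by positivity)]
    _ = _ := by
        simp only [ofReal_two_pow_div_two_rpow_neg]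
        rw [mul_assoc A]
        congr 1
        rw [← ENNReal.tsum_mul_left, ← ENNReal.tsum_mul_right]
        refine tsum_congr fun k => ?_
        ring

/-- The geometric sum controlling the interpolation constant. -/
theorem tsum_two_rpow_neg_le {ε : ℝ} (hε : 0 < ε) :
    ∑' k : ℕ, (2 : ℝ≥0∞) ^ (-(k * ε) : ℝ) ≤ ENNReal.ofReal ((ε + 2) / ε) := by
  have h1 : ∀ k : ℕ, (2 : ℝ≥0∞) ^ (-(k * ε) : ℝ) = ENNReal.ofReal (2 ^ (-ε)) ^ k := by
    intro k
    rw [← ENNReal.ofReal_rpow_of_pos two_pos, ENNReal.ofReal_ofNat, ← ENNReal.rpow_natCast,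
      ← ENNReal.rpow_mul]
    congr 1
    ring
  simp only [h1]
  rw [ENNReal.tsum_geometric, ← ENNReal.ofReal_one, ← ENNReal.ofReal_sub _ (by positivity)]
  -- This uses `log 2 > 1/2`.
  have h2 : 1 + ε / 2 ≤ (2 : ℝ) ^ ε := by
    rw [Real.rpow_def_of_pos two_pos]
    have := Real.add_one_le_exp (Real.log 2 * ε)
    nlinarith [Real.log_two_gt_d9]
  have h3 : ε / (ε + 2) ≤ 1 - 2 ^ (-ε) := by
    rw [Real.rpow_neg two_pos.le]
    have h4 : ((2 : ℝ) ^ ε)⁻¹ ≤ (1 + ε / 2)⁻¹ := inv_anti₀ (by positivity) h2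
    have h5 : (1 + ε / 2)⁻¹ = 2 / (ε + 2) := by field_simp; ring
    have h6 : ε / (ε + 2) = 1 - 2 / (ε + 2) := by field_simp; ring
    rw [h6]
    linarith
  have h7 : 0 < ε / (ε + 2) := by positivity
  rw [← ENNReal.ofReal_inv_of_pos (h7.trans_le h3)]
  apply ENNReal.ofReal_le_ofReal
  rw [← inv_div]
  exact inv_anti₀ h7 h3

/-- The power `q / p ≤ 1` passes inside the sum. The geometric series appears to the first power,
hence with power `1 / q` in the quasi-norm. -/
theorem lorentz_integral_le_of_le (hp : 0 < p) (hq : 0 < q) (hqp : q ≤ p) (hN : Antitone N)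
    {B : ℝ≥0∞} (hB : B ≠ ∞) {r : ℝ}
    (h : ∀ t, 0 < t → Φ t ≤ B * ∑' k : ℕ, 2 ^ ((k : ℝ) * r) * N (2 ^ k / 2 * t)) :
    ∫⁻ t in Ioi (0 : ℝ), (ENNReal.ofReal t * Φ t ^ (1 / p)) ^ q / ENNReal.ofReal t ≤
      B ^ (q / p) * (2 ^ q * ∑' k : ℕ, 2 ^ (-(k * ((p - r) * (q / p))) : ℝ)) *
        ∫⁻ t in Ioi (0 : ℝ), (ENNReal.ofReal t * N t ^ (1 / p)) ^ q / ENNReal.ofReal t := by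
  have hθ : 0 < q / p := by positivity
  have hθ1 : q / p ≤ 1 := (div_le_one hp).2 hqp
  refine (lorentz_integral_le_tsum hq.le hN (A := B ^ (q / p))
    (ENNReal.rpow_ne_top_of_nonneg hθ.le hB) (e := fun k => (2 ^ ((k : ℝ) * r)) ^ (q / p))
    fun t ht => ?_).trans_eq ?_
  · refine (ENNReal.rpow_le_rpow (h t ht) hθ.le).trans ?_
    rw [ENNReal.mul_rpow_of_nonneg _ _ hθ.le]
    gcongr
    refine (rpow_tsum_le_tsum_rpow _ hθ hθ1).trans_eq ?_
    simp only [ENNReal.mul_rpow_of_nonneg _ _ hθ.le]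
  · congr 3
    refine tsum_congr fun k => ?_
    rw [← ENNReal.rpow_mul, ← ENNReal.rpow_add _ _ two_ne_zero ENNReal.ofNat_ne_top]
    congr 1
    field_simp
    ring

/-- Convexity is applied with weights `2^{-k(p-r)}`, leaving `2^{kp}` with the distribution
function. After integration the factors `2^{kq}` and `2^{-kq}` cancel, so the series enters with
power `q / p`, and with power `1 / p` in the quasi-norm. -/
theorem lorentz_integral_le_of_ge (hp : 0 < p) (hpq : p ≤ q) (hN : Antitone N)
    {B : ℝ≥0∞} (hB : B ≠ ∞) {r : ℝ} (hr : r < p)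
    (h : ∀ t, 0 < t → Φ t ≤ B * ∑' k : ℕ, 2 ^ ((k : ℝ) * r) * N (2 ^ k / 2 * t)) :
    ∫⁻ t in Ioi (0 : ℝ), (ENNReal.ofReal t * Φ t ^ (1 / p)) ^ q / ENNReal.ofReal t ≤
      B ^ (q / p) * (2 ^ q * (∑' k : ℕ, 2 ^ (-(k * (p - r)) : ℝ)) ^ (q / p)) *
        ∫⁻ t in Ioi (0 : ℝ), (ENNReal.ofReal t * N t ^ (1 / p)) ^ q / ENNReal.ofReal t := by
  have hq : 0 < q := hp.trans_le hpq
  have hθ : 0 < q / p := by positivity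
  have hθ1 : 1 ≤ q / p := (one_le_div hp).2 hpq
  set S := ∑' k : ℕ, (2 : ℝ≥0∞) ^ (-(k * (p - r)) : ℝ) with hS
  have hSt : S ≠ ∞ :=
    ne_top_of_le_ne_top ENNReal.ofReal_ne_top (tsum_two_rpow_neg_le (sub_pos.2 hr))
  have hSpow : S ^ (q / p - 1) * S = S ^ (q / p) := by
    conv_lhs => rw [← ENNReal.rpow_one S, ← ENNReal.rpow_mul, one_mul]
    rw [← ENNReal.rpow_add_of_nonneg _ _ (by linarith) zero_le_one, sub_add_cancel]
  refine (lorentz_integral_le_tsum hq.le hN (A := B ^ (q / p) * S ^ (q / p - 1))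
    (ENNReal.mul_ne_top (ENNReal.rpow_ne_top_of_nonneg hθ.le hB)
      (ENNReal.rpow_ne_top_of_nonneg (by linarith) hSt))
    (e := fun k => 2 ^ (-(k * (p - r)) : ℝ) * (2 ^ ((k : ℝ) * p)) ^ (q / p))
    fun t ht => ?_).trans_eq ?_
  · refine (ENNReal.rpow_le_rpow (h t ht) hθ.le).trans ?_
    rw [ENNReal.mul_rpow_of_nonneg _ _ hθ.le, mul_assoc]
    gcongr
    have h1 : ∀ k : ℕ, (2 : ℝ≥0∞) ^ ((k : ℝ) * r) * N (2 ^ k / 2 * t) =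
        2 ^ (-(k * (p - r)) : ℝ) * (2 ^ ((k : ℝ) * p) * N (2 ^ k / 2 * t)) := by
      intro k
      rw [← mul_assoc, ← ENNReal.rpow_add _ _ two_ne_zero ENNReal.ofNat_ne_top]
      congr 2
      ring
    simp only [h1]
    refine (rpow_tsum_mul_le _ _ hθ1).trans_eq ?_
    simp only [ENNReal.mul_rpow_of_nonneg _ _ hθ.le, mul_assoc, hS]
  · have h2 : ∑' k : ℕ, 2 ^ (-(k * (p - r)) : ℝ) * ((2 : ℝ≥0∞) ^ ((k : ℝ) * p)) ^ (q / p) *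
        2 ^ (-(k * q) : ℝ) = S := by
      refine tsum_congr fun k => ?_
      rw [← ENNReal.rpow_mul, mul_assoc, ← ENNReal.rpow_add _ _ two_ne_zero ENNReal.ofNat_ne_top]
      have : (k : ℝ) * p * (q / p) + -(k * q) = 0 := by field_simp; ring
      rw [this, ENNReal.rpow_zero, mul_one]
    rw [h2, ← hSpow]
    ring

theorem lorentz_iSup_le (hp : 0 < p) {B : ℝ≥0∞} {r : ℝ}
    (h : ∀ t, 0 < t → Φ t ≤ B * ∑' k : ℕ, 2 ^ ((k : ℝ) * r) * N (2 ^ k / 2 * t)) :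
    ⨆ (t : ℝ) (_ : 0 < t), ENNReal.ofReal t * Φ t ^ (1 / p) ≤
      2 * (B * ∑' k : ℕ, 2 ^ (-(k * (p - r)) : ℝ)) ^ (1 / p) *
        ⨆ (t : ℝ) (_ : 0 < t), ENNReal.ofReal t * N t ^ (1 / p) := by
  set M := ⨆ (t : ℝ) (_ : 0 < t), ENNReal.ofReal t * N t ^ (1 / p) with hM
  have hp1 : 0 ≤ 1 / p := by positivity
  refine iSup_le fun t => iSup_le fun ht => ?_
  have hNle : ∀ s, 0 < s → N s ≤ ENNReal.ofReal s ^ (-p) * M ^ p := by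
    intro s hs
    have hs0 : ENNReal.ofReal s ≠ 0 := by simpa using hs
    have h1 : ENNReal.ofReal s * N s ^ (1 / p) ≤ M := le_iSup_of_le s (le_iSup_of_le hs le_rfl)
    have h2 := ENNReal.rpow_le_rpow h1 hp.le
    rw [ENNReal.mul_rpow_of_nonneg _ _ hp.le, ← ENNReal.rpow_mul, one_div_mul_cancel hp.ne',
      ENNReal.rpow_one] at h2
    calc N s = ENNReal.ofReal s ^ (-p) * (ENNReal.ofReal s ^ p * N s) := by
          rw [← mul_assoc, ← ENNReal.rpow_add _ _ hs0 ENNReal.ofReal_ne_top, neg_add_cancel,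
            ENNReal.rpow_zero, one_mul]
      _ ≤ _ := by gcongr
  have ht0 : ENNReal.ofReal t ≠ 0 := by simpa using ht
  set S := ∑' k : ℕ, (2 : ℝ≥0∞) ^ (-(k * (p - r)) : ℝ) with hS
  have hΦ : Φ t ≤ B * S * (2 ^ p * (ENNReal.ofReal t ^ (-p) * M ^ p)) := by
    refine (h t ht).trans ?_
    rw [mul_assoc, hS, ← ENNReal.tsum_mul_right]
    refine mul_le_mul_right (ENNReal.tsum_le_tsum fun k => ?_) _
    refine (mul_le_mul_right (hNle _ (by positivity)) _).trans_eq ?_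
    rw [ENNReal.ofReal_mul (by positivity), ENNReal.mul_rpow_of_ne_top ENNReal.ofReal_ne_top
      ENNReal.ofReal_ne_top, ofReal_two_pow_div_two_rpow_neg]
    have : (2 : ℝ≥0∞) ^ (-(k * (p - r)) : ℝ) = 2 ^ ((k : ℝ) * r) * 2 ^ (-(k * p) : ℝ) := by
      rw [← ENNReal.rpow_add _ _ two_ne_zero ENNReal.ofNat_ne_top]
      congr 1
      ring
    rw [this]
    ring
  have hinv : ∀ x : ℝ≥0∞, (x ^ p) ^ (1 / p) = x := fun x => by
    rw [← ENNReal.rpow_mul, mul_one_div_cancel hp.ne', ENNReal.rpow_one]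
  calc ENNReal.ofReal t * Φ t ^ (1 / p)
      ≤ ENNReal.ofReal t * (B * S * (2 ^ p * (ENNReal.ofReal t ^ (-p) * M ^ p))) ^ (1 / p) := by
        gcongr
    _ = ENNReal.ofReal t * ((B * S) ^ (1 / p) * (2 * ((ENNReal.ofReal t)⁻¹ * M))) := by
        rw [ENNReal.mul_rpow_of_nonneg (B * S) _ hp1, ENNReal.mul_rpow_of_nonneg (2 ^ p) _ hp1,
          ENNReal.mul_rpow_of_nonneg (ENNReal.ofReal t ^ (-p)) _ hp1, hinv, hinv, ← ENNReal.rpow_mul, neg_mul,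
          mul_one_div_cancel hp.ne', ENNReal.rpow_neg_one]
    _ = ENNReal.ofReal t * (ENNReal.ofReal t)⁻¹ * (2 * (B * S) ^ (1 / p) * M) := by ring
    _ = _ := by rw [ENNReal.mul_inv_cancel ht0 ENNReal.ofReal_ne_top, one_mul]

end

section

variable {p : ℝ} {w : ℝ → ℝ≥0∞}

/-! ### Lorentz bounds for the one-sided maximal operator -/

/-- The part of `g` below `t / 2` contributes at most `t / 2` to any average. -/
theorem lt_maximalPlus_indicator {g : ℝ → ℝ≥0∞} {t x : ℝ} (ht : 0 ≤ t)
    (hg : Measurable g)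
    (h : ENNReal.ofReal t < maximalPlus g x) :
    ENNReal.ofReal (t / 2) <
      maximalPlus ({y | ENNReal.ofReal (t / 2) < g y}.indicator g) x := by
  obtain ⟨y, hxy, hlt⟩ := (lt_maximalPlus_iff ht).1 h
  refine (lt_maximalPlus_iff (by positivity)).2 ⟨y, hxy, ?_⟩
  set S := {y | ENNReal.ofReal (t / 2) < g y} with hS
  have hSm : MeasurableSet S := measurableSet_lt measurable_const hg
  have h1 : ∫⁻ z in Ioo x y, g z ≤
      (∫⁻ z in Ioo x y, S.indicator g z) + ENNReal.ofReal (t / 2 * (y - x)) := by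
    calc ∫⁻ z in Ioo x y, g z
        ≤ ∫⁻ z in Ioo x y, (S.indicator g z + ENNReal.ofReal (t / 2)) := by
          refine lintegral_mono fun z => ?_
          by_cases hz : z ∈ S
          · rw [indicator_of_mem hz]
            exact le_self_add
          · rw [indicator_of_notMem hz, zero_add]
            exact not_lt.1 hz
      _ = _ := by
          rw [lintegral_add_right _ measurable_const, lintegral_const, Measure.restrict_apply_univ,
            Real.volume_Ioo, ← ENNReal.ofReal_mul (by positivity)]
  by_contra hle
  refine absurd hlt (not_lt.2 (h1.trans ?_))
  calc (∫⁻ z in Ioo x y, S.indicator g z) + ENNReal.ofReal (t / 2 * (y - x))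
      ≤ ENNReal.ofReal (t / 2 * (y - x)) + ENNReal.ofReal (t / 2 * (y - x)) := by
        gcongr
        exact not_lt.1 hle
    _ = ENNReal.ofReal (t * (y - x)) := by
        have : 0 ≤ t / 2 * (y - x) := mul_nonneg (by positivity) (sub_pos.2 hxy).le
        rw [← ENNReal.ofReal_add this this]
        congr 1
        ring

/-- A single term suffices, for the least `k` with `g x ≤ 2^k t`; it exists because `g x` is finite.
-/
theorem indicator_rpow_le_tsum {Ω : Type*} {g : Ω → ℝ≥0∞} {t r : ℝ} (ht : 0 < t) (hr : 0 < r)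
    {x : Ω} (hgt : g x ≠ ∞) :
    {y | ENNReal.ofReal (t / 2) < g y}.indicator g x ^ r ≤
      ∑' k : ℕ, {y | ENNReal.ofReal (2 ^ k / 2 * t) < g y}.indicator
        (fun _ => ENNReal.ofReal (2 ^ k * t) ^ r) x := by
  by_cases hx : ENNReal.ofReal (t / 2) < g x
  · have hex : ∃ k : ℕ, g x ≤ ENNReal.ofReal (2 ^ k * t) := by
      obtain ⟨k, hk⟩ := pow_unbounded_of_one_lt ((g x).toReal / t) (one_lt_two (α := ℝ))
      refine ⟨k, ?_⟩
      rw [← ENNReal.ofReal_toReal hgt]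
      exact ENNReal.ofReal_le_ofReal ((div_lt_iff₀ ht).1 hk).le
    classical
    set k := Nat.find hex with hk
    have hk1 : g x ≤ ENNReal.ofReal (2 ^ k * t) := Nat.find_spec hex
    have hk2 : ENNReal.ofReal (2 ^ k / 2 * t) < g x := by
      rcases Nat.eq_zero_or_pos k with h0 | h0
      · rw [h0, pow_zero]
        convert hx using 2
        ring
      · obtain ⟨m, hm⟩ := Nat.exists_eq_succ_of_ne_zero h0.ne'
        have := Nat.find_min hex (m := m) (by omega)
        rw [hm, Nat.succ_eq_add_one, pow_succ, mul_div_cancel_right₀ _ two_ne_zero]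
        exact not_le.1 this
    refine le_trans ?_ (ENNReal.le_tsum k)
    rw [indicator_of_mem (show x ∈ {y | ENNReal.ofReal (t / 2) < g y} from hx),
      indicator_of_mem (show x ∈ {y | ENNReal.ofReal (2 ^ k / 2 * t) < g y} from hk2)]
    gcongr
  · rw [indicator_of_notMem (show x ∉ {y | ENNReal.ofReal (t / 2) < g y} from hx),
      ENNReal.zero_rpow_of_pos hr]
    exact zero_le

theorem weight_lt_maximalPlus_le_tsum {r : ℝ} (hr : 1 < r) (hw : AEMeasurable w volume)
    (hwt : ∀ x, w x ≠ ∞) (hA : apPlusConst r w ≠ ∞) {g : ℝ → ℝ≥0∞} (hg : Measurable g)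
    (hgt : ∀ x, g x ≠ ∞) {t : ℝ} (ht : 0 < t) :
    (volume.withDensity w) {x | ENNReal.ofReal t < maximalPlus g x} ≤
      2 * 8 ^ r * apPlusConst r w * ∑' k : ℕ, 2 ^ ((k : ℝ) * r) *
        (volume.withDensity w) {x | ENNReal.ofReal (2 ^ k / 2 * t) < g x} := by
  have hr0 : 0 < r := by linarith
  set μ := volume.withDensity w with hμ
  set h := {y | ENNReal.ofReal (t / 2) < g y}.indicator g with hh
  have hset : ∀ s, MeasurableSet {y | ENNReal.ofReal s < g y} := fun s =>
    measurableSet_lt measurable_const hg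
  have hhm : Measurable h := hg.indicator (hset _)
  set T := ENNReal.ofReal (t / 2) ^ r with hT
  have hT0 : T ≠ 0 := by simp [hT, ht]
  have hTt : T ≠ ∞ := ENNReal.rpow_ne_top_of_nonneg hr0.le ENNReal.ofReal_ne_top
  have h1 : T * μ {x | ENNReal.ofReal t < maximalPlus g x} ≤
      2 * 4 ^ r * apPlusConst r w * ∫⁻ x, w x * h x ^ r := by
    refine le_trans ?_ (weight_lt_maximalPlus_le hr hw hwt hA hhm.aemeasurable
      (show 0 < t / 2 by positivity))
    exact mul_le_mul_right (measure_mono fun x hx => lt_maximalPlus_indicator ht.le hg hx) _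
  have h2 : ∫⁻ x, w x * h x ^ r ≤ ∑' k : ℕ, ENNReal.ofReal (2 ^ k * t) ^ r *
      μ {x | ENNReal.ofReal (2 ^ k / 2 * t) < g x} := by
    have : ∫⁻ x, w x * h x ^ r = ∫⁻ x, h x ^ r ∂μ := by
      rw [hμ, lintegral_withDensity_eq_lintegral_mul₀ hw (hhm.pow_const r).aemeasurable]
      rfl
    rw [this]
    refine (lintegral_mono fun x => indicator_rpow_le_tsum ht hr0 (hgt x)).trans_eq ?_
    rw [lintegral_tsum fun k => (measurable_const.indicator (hset _)).aemeasurable]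
    exact tsum_congr fun k => lintegral_indicator_const (hset _) _
  have h3 : ∀ k : ℕ, ENNReal.ofReal (2 ^ k * t) ^ r = T * (2 ^ r * 2 ^ ((k : ℝ) * r)) := by
    intro k
    rw [ENNReal.rpow_mul, ENNReal.rpow_natCast, hT, ← ENNReal.mul_rpow_of_nonneg _ _ hr0.le,
      ← ENNReal.mul_rpow_of_nonneg _ _ hr0.le]
    congr 1
    rw [← ENNReal.ofReal_ofNat 2, ← ENNReal.ofReal_pow two_pos.le, ← ENNReal.ofReal_mul two_pos.le,
      ← ENNReal.ofReal_mul (by positivity)]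
    congr 1
    ring
  have h8 : (8 : ℝ≥0∞) ^ r = 4 ^ r * 2 ^ r := by
    rw [← ENNReal.mul_rpow_of_nonneg _ _ hr0.le]
    norm_num
  rw [← ENNReal.mul_le_mul_iff_right hT0 hTt]
  refine (h1.trans (mul_le_mul_right h2 _)).trans_eq ?_
  simp only [h3]
  rw [h8, ← ENNReal.tsum_mul_left, ← ENNReal.tsum_mul_left, ← ENNReal.tsum_mul_left]
  refine tsum_congr fun k => ?_
  ring

/-- `M⁺` integrates against Lebesgue measure while `f` is determined only `w`-almost everywhere. At
`w`-almost every `x` the weight is nonzero almost everywhere on `(x, ∞)`, so the two notions agree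
on the part of the line that `M⁺` sees from `x`. -/
theorem maximalPlus_congr_ae (hp : 1 < p) (hw : AEMeasurable w volume)
    (hA : apPlusConst p w ≠ ∞) {f g : ℝ → ℂ} (hfg : f =ᵐ[volume.withDensity w] g) :
    maximalPlus f =ᵐ[volume.withDensity w] maximalPlus g := by
  have hU : ∀ᵐ x ∂volume.withDensity w, x ∈ rightSupport w := by
    rw [ae_iff]
    exact weight_compl_rightSupport
  filter_upwards [hU] with x hx
  have h1 : ∀ᵐ y ∂volume.restrict (Ioi x), f y = g y := by
    have h2 := (ae_withDensity_iff' hw).1 hfg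
    filter_upwards [ae_restrict_of_ae h2, ae_ne_zero_of_mem_rightSupport hp hw hA hx] with y hy hy0
    exact hy hy0
  simp only [maximalPlus]
  congr! 4 with h hh
  refine lintegral_congr_ae ?_
  filter_upwards [ae_restrict_of_ae_restrict_of_subset Ioo_subset_Ioi_self h1] with y hy
  rw [hy]

theorem weight_lt_maximalPlus_enorm_le_tsum {r : ℝ} (hr : 1 < r) (hw : AEMeasurable w volume)
    (hwt : ∀ x, w x ≠ ∞) (hA : apPlusConst r w ≠ ∞) {f : ℝ → ℂ}
    (hf : AEStronglyMeasurable f (volume.withDensity w)) {t : ℝ} (ht : 0 < t) :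
    (volume.withDensity w) {x | ENNReal.ofReal t < ‖maximalPlus f x‖ₑ} ≤
      2 * 8 ^ r * apPlusConst r w * ∑' k : ℕ, 2 ^ ((k : ℝ) * r) *
        (volume.withDensity w) {x | ENNReal.ofReal (2 ^ k / 2 * t) < ‖f x‖ₑ} := by
  have h := weight_lt_maximalPlus_le_tsum hr hw hwt hA
    (hf.stronglyMeasurable_mk.enorm) (fun x => enorm_ne_top) ht
  rw [maximalPlus_enorm] at h
  have h1 : ∀ s : ℝ, (volume.withDensity w) {x | ENNReal.ofReal s < ‖f x‖ₑ} =
      (volume.withDensity w) {x | ENNReal.ofReal s < ‖hf.mk f x‖ₑ} := by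
    intro s
    refine measure_congr ?_
    filter_upwards [hf.ae_eq_mk] with x hx
    exact congrArg (fun z : ℂ => ENNReal.ofReal s < ‖z‖ₑ) hx
  have h2 : (volume.withDensity w) {x | ENNReal.ofReal t < ‖maximalPlus f x‖ₑ} =
      (volume.withDensity w) {x | ENNReal.ofReal t < maximalPlus (hf.mk f) x} := by
    refine measure_congr ?_
    filter_upwards [maximalPlus_congr_ae hr hw hA hf.ae_eq_mk] with x hx
    exact congrArg (fun z : ℝ≥0∞ => ENNReal.ofReal t < z) ((enorm_eq_self _).trans hx)
  simp only [h1, h2]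
  exact h

theorem antitone_distribution {Ω E : Type*} [MeasurableSpace Ω] [ENorm E] (μ : Measure Ω)
    (f : Ω → E) : Antitone fun t : ℝ => μ {x | ENNReal.ofReal t < ‖f x‖ₑ} :=
  fun _ _ hst => measure_mono fun _ hx => (ENNReal.ofReal_le_ofReal hst).trans_lt hx

theorem one_le_aInftyMinusConst_dual (hp : 1 < p) (hw : AEMeasurable w volume) (hwt : ∀ x, w x ≠ ∞)
    (hA : apPlusConst p w ≠ ∞) (h0 : volume.withDensity w ≠ 0) :
    1 ≤ aInftyMinusConst (fun x => w x ^ (-1 / (p - 1))) := by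
  have hne : (rightSupport w).Nonempty := by
    by_contra h
    rw [not_nonempty_iff_eq_empty] at h
    have h1 := weight_compl_rightSupport (w := w)
    rw [h, compl_empty] at h1
    exact h0 (Measure.measure_univ_eq_zero.1 h1)
  obtain ⟨a, ha⟩ := hne
  exact one_le_aInftyMinusConst (a := a) (c := a + 1) (aemeasurable_dual hw)
    (dual_ne_zero hp hw hwt (by linarith)) (dual_ne_top_of_mem_rightSupport hp hA ha _)

/-- The weak type estimate at an exponent `r < p` with `p - r` comparable to the inverse of the
one-sided `A_∞` constant of the dual weight, and with controlled geometric sums. -/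
theorem exists_exponent_lt (hp : 1 < p) (hw : AEMeasurable w volume) (hwt : ∀ x, w x ≠ ∞)
    (hloc : ∀ a b, ∫⁻ x in Ioo a b, w x ≠ ∞)
    (hA : apPlusConst p w ≠ ∞) (h0 : volume.withDensity w ≠ 0) :
    ∃ r, r < p ∧
      (∀ θ, 0 < θ → θ ≤ 1 → ∑' k : ℕ, (2 : ℝ≥0∞) ^ (-(k * ((p - r) * θ)) : ℝ) ≤
        ENNReal.ofReal (3 * (p + 2) / ((p - 1) * θ)) *
          aInftyMinusConst (fun x => w x ^ (-1 / (p - 1)))) ∧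
      ∀ f : ℝ → ℂ, AEStronglyMeasurable f (volume.withDensity w) → ∀ t : ℝ, 0 < t →
        (volume.withDensity w) {x | ENNReal.ofReal t < ‖maximalPlus f x‖ₑ} ≤
          4 * 8 ^ p * 8 ^ (p - 1) * apPlusConst p w * ∑' k : ℕ, 2 ^ ((k : ℝ) * r) *
            (volume.withDensity w) {x | ENNReal.ofReal (2 ^ k / 2 * t) < ‖f x‖ₑ} := by
  set K := aInftyMinusConst (fun x => w x ^ (-1 / (p - 1))) with hK
  have hp1 : 0 < p - 1 := by linarith
  have hKt : K ≠ ∞ := aInftyMinusConst_dual_ne_top hp hw hwt hA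
  have hK1 : 1 ≤ K := one_le_aInftyMinusConst_dual hp hw hwt hA h0
  set κ := K.toReal with hκ
  have hκ1 : 1 ≤ κ := by
    rw [hκ, ← ENNReal.toReal_one]
    exact ENNReal.toReal_mono hKt hK1
  have hKκ : K = ENNReal.ofReal κ := (ENNReal.ofReal_toReal hKt).symm
  set δ := 1 / (2 * κ) with hδ
  have hδ0 : 0 < δ := by positivity
  have hδK : K * ENNReal.ofReal δ ≤ 2⁻¹ := by
    rw [hKκ, ← ENNReal.ofReal_mul (by positivity), ← ENNReal.ofReal_ofNat 2,
      ← ENNReal.ofReal_inv_of_pos two_pos]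
    apply ENNReal.ofReal_le_ofReal
    rw [hδ]
    field_simp
    exact le_rfl
  set r := 1 + (p - 1) / (1 + δ) with hr
  have hr1 : 1 < r := by
    have : 0 < (p - 1) / (1 + δ) := by positivity
    linarith
  -- This makes `1 / (p - r)` linear in `κ`; below, `κ ≥ 1` turns `2 κ + 1` into `3 κ`.
  have hpr : p - r = (p - 1) / (2 * κ + 1) := by
    rw [hr, hδ]
    field_simp
    ring
  have hpr0 : 0 < p - r := by rw [hpr]; positivity
  have hAr : apPlusConst r w ≤ 2 * 8 ^ (p - 1) * apPlusConst p w :=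
    apPlusConst_self_improve hp hw hwt hloc hA hδ0 hδK
  have h8 : (8 : ℝ≥0∞) ^ (p - 1) ≠ ∞ := ENNReal.rpow_ne_top_of_nonneg hp1.le ENNReal.ofNat_ne_top
  have hArt : apPlusConst r w ≠ ∞ := ne_top_of_le_ne_top
    (ENNReal.mul_ne_top (ENNReal.mul_ne_top ENNReal.ofNat_ne_top h8) hA) hAr
  refine ⟨r, by linarith, fun θ hθ hθ1 => ?_, fun f hf t ht => ?_⟩
  · refine (tsum_two_rpow_neg_le (mul_pos hpr0 hθ)).trans ?_
    rw [hKκ, ← ENNReal.ofReal_mul (by positivity)]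
    apply ENNReal.ofReal_le_ofReal
    have hle : (p - r) * θ ≤ p := by nlinarith
    calc ((p - r) * θ + 2) / ((p - r) * θ) ≤ (p + 2) / ((p - r) * θ) := by gcongr
      _ = (p + 2) * (2 * κ + 1) / ((p - 1) * θ) := by
          rw [hpr]
          field_simp
      _ ≤ (p + 2) * (3 * κ) / ((p - 1) * θ) := by
          gcongr
          linarith
      _ = _ := by ring
  · refine (weight_lt_maximalPlus_enorm_le_tsum hr1 hw hwt hArt hf ht).trans (mul_le_mul_left ?_ _)
    calc 2 * 8 ^ r * apPlusConst r w ≤ 2 * 8 ^ p * (2 * 8 ^ (p - 1) * apPlusConst p w) := by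
          gcongr
          · norm_num
          · linarith
      _ = _ := by ring

theorem lorentzNorm_maximalPlus_le_of_ge (hp : 1 < p) {q : ℝ≥0∞}
    (hpq : ENNReal.ofReal p ≤ q) (hw : AEMeasurable w volume) (hwt : ∀ x, w x ≠ ∞)
    (hloc : ∀ a b, ∫⁻ x in Ioo a b, w x ≠ ∞)
    (hA : apPlusConst p w ≠ ∞) (h0 : volume.withDensity w ≠ 0) {f : ℝ → ℂ}
    (hf : AEStronglyMeasurable f (volume.withDensity w)) :
    lorentzNorm p q (volume.withDensity w) (maximalPlus f) ≤
      2 * (4 * 8 ^ p * 8 ^ (p - 1) * apPlusConst p w * (ENNReal.ofReal (3 * (p + 2) / (p - 1)) *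
        aInftyMinusConst (fun x => w x ^ (-1 / (p - 1))))) ^ (1 / p) *
          lorentzNorm p q (volume.withDensity w) f := by
  obtain ⟨r, hrp, hsum, hweak⟩ := exists_exponent_lt hp hw hwt hloc hA h0
  have hp0 : 0 < p := by linarith
  have hp1 : 0 < p - 1 := by linarith
  have hs := hsum 1 one_pos le_rfl
  simp only [mul_one] at hs
  set D := ENNReal.ofReal (3 * (p + 2) / (p - 1)) * aInftyMinusConst (fun x => w x ^ (-1 / (p - 1)))
  set B := 4 * 8 ^ p * 8 ^ (p - 1) * apPlusConst p w with hB
  have h8 : ∀ s : ℝ, 0 ≤ s → (8 : ℝ≥0∞) ^ s ≠ ∞ := fun s hs =>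
    ENNReal.rpow_ne_top_of_nonneg hs ENNReal.ofNat_ne_top
  have hBt : B ≠ ∞ := ENNReal.mul_ne_top (ENNReal.mul_ne_top (ENNReal.mul_ne_top
    ENNReal.ofNat_ne_top (h8 p hp0.le)) (h8 _ hp1.le)) hA
  rcases eq_or_ne q ∞ with rfl | hq
  · simp only [lorentzNorm, if_true]
    refine (lorentz_iSup_le
      (N := fun t => (volume.withDensity w) {x | ENNReal.ofReal t < ‖f x‖ₑ}) hp0 (hweak f hf)).trans ?_
    gcongr
  · have hq' : p ≤ q.toReal := (ENNReal.ofReal_le_iff_le_toReal hq).1 hpq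
    have hq0 : 0 < q.toReal := hp0.trans_le hq'
    have hq1 : 0 ≤ 1 / q.toReal := by positivity
    simp only [lorentzNorm, if_neg hq]
    have h1 := lorentz_integral_le_of_ge hp0 hq' (antitone_distribution (volume.withDensity w) f)
      hBt hrp (hweak f hf)
    set J := ∫⁻ t in Ioi (0 : ℝ), (ENNReal.ofReal t *
      (volume.withDensity w) {x | ENNReal.ofReal t < ‖f x‖ₑ} ^ (1 / p)) ^ q.toReal /
        ENNReal.ofReal t
    set S := ∑' k : ℕ, (2 : ℝ≥0∞) ^ (-(k * (p - r)) : ℝ)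
    calc _ ≤ (ENNReal.ofReal p * (B ^ (q.toReal / p) *
            (2 ^ q.toReal * S ^ (q.toReal / p)) * J)) ^ (1 / q.toReal) := by gcongr
      _ = ((2 * (B * S) ^ (1 / p)) ^ q.toReal * (ENNReal.ofReal p * J)) ^ (1 / q.toReal) := by
          congr 1
          rw [ENNReal.mul_rpow_of_nonneg _ _ hq0.le, ← ENNReal.rpow_mul, one_div_mul_eq_div,
            ENNReal.mul_rpow_of_nonneg B S (by positivity)]
          ring
      _ = 2 * (B * S) ^ (1 / p) * (ENNReal.ofReal p * J) ^ (1 / q.toReal) := by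
          rw [ENNReal.mul_rpow_of_nonneg _ _ hq1, ← ENNReal.rpow_mul,
            mul_one_div_cancel hq0.ne', ENNReal.rpow_one]
      _ ≤ _ := by gcongr

theorem lorentzNorm_maximalPlus_le_of_le (hp : 1 < p) {q : ℝ≥0∞} (hq : 0 < q)
    (hqp : q ≤ ENNReal.ofReal p) (hw : AEMeasurable w volume) (hwt : ∀ x, w x ≠ ∞)
    (hloc : ∀ a b, ∫⁻ x in Ioo a b, w x ≠ ∞)
    (hA : apPlusConst p w ≠ ∞) (h0 : volume.withDensity w ≠ 0) {f : ℝ → ℂ}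
    (hf : AEStronglyMeasurable f (volume.withDensity w)) :
    lorentzNorm p q (volume.withDensity w) (maximalPlus f) ≤
      2 * (4 * 8 ^ p * 8 ^ (p - 1) * apPlusConst p w) ^ (1 / p) *
        (ENNReal.ofReal (3 * (p + 2) / ((p - 1) * (q.toReal / p))) *
          aInftyMinusConst (fun x => w x ^ (-1 / (p - 1)))) ^ (1 / q.toReal) *
            lorentzNorm p q (volume.withDensity w) f := by
  obtain ⟨r, hrp, hsum, hweak⟩ := exists_exponent_lt hp hw hwt hloc hA h0
  have hp0 : 0 < p := by linarith
  have hp1 : 0 < p - 1 := by linarith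
  have hqt : q ≠ ∞ := ne_top_of_le_ne_top ENNReal.ofReal_ne_top hqp
  have hq0 : 0 < q.toReal := ENNReal.toReal_pos hq.ne' hqt
  have hq1 : 0 ≤ 1 / q.toReal := by positivity
  have hq' : q.toReal ≤ p := ENNReal.toReal_le_of_le_ofReal hp0.le hqp
  have hs := hsum (q.toReal / p) (by positivity) ((div_le_one hp0).2 hq')
  set D := ENNReal.ofReal (3 * (p + 2) / ((p - 1) * (q.toReal / p))) *
    aInftyMinusConst (fun x => w x ^ (-1 / (p - 1)))
  set B := 4 * 8 ^ p * 8 ^ (p - 1) * apPlusConst p w with hB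
  have h8 : ∀ s : ℝ, 0 ≤ s → (8 : ℝ≥0∞) ^ s ≠ ∞ := fun s hs =>
    ENNReal.rpow_ne_top_of_nonneg hs ENNReal.ofNat_ne_top
  have hBt : B ≠ ∞ := ENNReal.mul_ne_top (ENNReal.mul_ne_top (ENNReal.mul_ne_top
    ENNReal.ofNat_ne_top (h8 p hp0.le)) (h8 _ hp1.le)) hA
  simp only [lorentzNorm, if_neg hqt]
  have h1 := lorentz_integral_le_of_le hp0 hq0 hq'
    (antitone_distribution (volume.withDensity w) f) hBt (hweak f hf)
  set J := ∫⁻ t in Ioi (0 : ℝ), (ENNReal.ofReal t *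
    (volume.withDensity w) {x | ENNReal.ofReal t < ‖f x‖ₑ} ^ (1 / p)) ^ q.toReal /
      ENNReal.ofReal t
  set S := ∑' k : ℕ, (2 : ℝ≥0∞) ^ (-(k * ((p - r) * (q.toReal / p))) : ℝ)
  calc _ ≤ (ENNReal.ofReal p * (B ^ (q.toReal / p) *
          (2 ^ q.toReal * S) * J)) ^ (1 / q.toReal) := by gcongr
    _ = ((2 * B ^ (1 / p)) ^ q.toReal * (S * (ENNReal.ofReal p * J))) ^ (1 / q.toReal) := by
        congr 1
        rw [ENNReal.mul_rpow_of_nonneg _ _ hq0.le, ← ENNReal.rpow_mul, one_div_mul_eq_div]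
        ring
    _ = 2 * B ^ (1 / p) * (S ^ (1 / q.toReal) * (ENNReal.ofReal p * J) ^ (1 / q.toReal)) := by
        rw [ENNReal.mul_rpow_of_nonneg _ _ hq1, ← ENNReal.rpow_mul,
          mul_one_div_cancel hq0.ne', ENNReal.rpow_one, ENNReal.mul_rpow_of_nonneg S _ hq1]
    _ ≤ 2 * B ^ (1 / p) * (D ^ (1 / q.toReal) * (ENNReal.ofReal p * J) ^ (1 / q.toReal)) := by
        gcongr
    _ = _ := by rw [← mul_assoc]

/-! ### Degenerate measures, real-valued weights and the final bound -/

theorem lorentzNorm_zero_measure (hp : 0 < p) {q : ℝ≥0∞} (hq : 0 < q) {Ω E : Type*}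
    [MeasurableSpace Ω] [ENorm E] (f : Ω → E) : lorentzNorm p q (0 : Measure Ω) f = 0 := by
  have hp1 : 0 < p⁻¹ := by positivity
  rcases eq_or_ne q ∞ with rfl | hqt
  · simp [lorentzNorm, ENNReal.zero_rpow_of_pos hp1]
  · have hq0 : 0 < q.toReal := ENNReal.toReal_pos hq.ne' hqt
    have hq1 : 0 < (q.toReal)⁻¹ := by positivity
    simp [lorentzNorm, hqt, ENNReal.zero_rpow_of_pos hp1, ENNReal.zero_rpow_of_pos hq0,
      ENNReal.zero_rpow_of_pos hq1]

theorem dualWeight_eq (hp : 1 < p) (w : ℝ → ℝ≥0∞) :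
    dualWeight p w = fun x => w x ^ (-1 / (p - 1)) := by
  ext x
  have : p - 1 ≠ 0 := by linarith
  rw [dualWeight, Real.conjExponent]
  congr 1
  field_simp
  ring

theorem aemeasurable_toWeight {w : ℝ → ℝ} (hw : LocallyIntegrable w volume) :
    AEMeasurable (toWeight w) volume :=
  hw.aestronglyMeasurable.aemeasurable.ennreal_ofReal

theorem setLIntegral_toWeight_ne_top {w : ℝ → ℝ} (hw : LocallyIntegrable w volume) (a b : ℝ) :
    ∫⁻ x in Ioo a b, toWeight w x ≠ ∞ := by
  have h : IntegrableOn w (Ioo a b) :=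
    (hw.integrableOn_isCompact isCompact_Icc).mono_set Ioo_subset_Icc_self
  refine ne_top_of_le_ne_top h.2.ne (lintegral_mono fun x => ?_)
  rw [toWeight, Real.enorm_eq_ofReal_abs]
  exact ENNReal.ofReal_le_ofReal (le_abs_self _)

end

end OneSided

theorem theorem1p1 (p : ℝ) (hp : 1 < p) (q : ℝ≥0∞) (hq : 0 < q) :
    ∃ C : ℝ≥0, ∀ w : ℝ → ℝ, (∀ x, 0 ≤ w x) → LocallyIntegrable w volume →
      OneSided.apPlusConst p (OneSided.toWeight w) < ∞ →
      (∀ f : ℝ → ℂ,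
        OneSided.MemLorentz p q (volume.withDensity (OneSided.toWeight w)) f →
        OneSided.MemLorentz p q (volume.withDensity (OneSided.toWeight w))
          (OneSided.maximalPlus f)) ∧
      OneSided.maximalPlusNorm p q (OneSided.toWeight w) < ∞ ∧
      (ENNReal.ofReal p ≤ q →
        OneSided.maximalPlusNorm p q (OneSided.toWeight w) ≤
          C * OneSided.aInftyMinusConst
                (OneSided.dualWeight p (OneSided.toWeight w)) ^ (1 / p) *
            OneSided.apPlusConst p (OneSided.toWeight w) ^ (1 / p)) ∧
      (q ≤ ENNReal.ofReal p →
        OneSided.maximalPlusNorm p q (OneSided.toWeight w) ≤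
          C * OneSided.aInftyMinusConst
                (OneSided.dualWeight p (OneSided.toWeight w)) ^ (1 / q.toReal) *
            OneSided.apPlusConst p (OneSided.toWeight w) ^ (1 / p)) := by
  have hp0 : 0 < p := by linarith
  have hp1 : 0 < p - 1 := by linarith
  have hpi : 0 ≤ 1 / p := by positivity
  have hqi : 0 ≤ 1 / q.toReal := by positivity
  set B : ℝ≥0∞ := 4 * 8 ^ p * 8 ^ (p - 1) with hB
  set D₁ : ℝ≥0∞ := ENNReal.ofReal (3 * (p + 2) / (p - 1)) with hD₁
  set D₂ : ℝ≥0∞ := ENNReal.ofReal (3 * (p + 2) / ((p - 1) * (q.toReal / p))) with hD₂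
  set C₁ : ℝ≥0∞ := 2 * (B * D₁) ^ (1 / p) with hC₁
  set C₂ : ℝ≥0∞ := 2 * B ^ (1 / p) * D₂ ^ (1 / q.toReal) with hC₂
  have h8 : ∀ s : ℝ, 0 ≤ s → (8 : ℝ≥0∞) ^ s ≠ ∞ := fun s hs =>
    ENNReal.rpow_ne_top_of_nonneg hs ENNReal.ofNat_ne_top
  have hBt : B ≠ ∞ :=
    ENNReal.mul_ne_top (ENNReal.mul_ne_top ENNReal.ofNat_ne_top (h8 p hp0.le)) (h8 _ hp1.le)
  have hC₁t : C₁ ≠ ∞ := ENNReal.mul_ne_top ENNReal.ofNat_ne_top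
    (ENNReal.rpow_ne_top_of_nonneg hpi (ENNReal.mul_ne_top hBt ENNReal.ofReal_ne_top))
  have hC₂t : C₂ ≠ ∞ := ENNReal.mul_ne_top (ENNReal.mul_ne_top ENNReal.ofNat_ne_top
    (ENNReal.rpow_ne_top_of_nonneg hpi hBt))
    (ENNReal.rpow_ne_top_of_nonneg hqi ENNReal.ofReal_ne_top)
  refine ⟨(C₁ + C₂).toNNReal, fun w _ hloc hA => ?_⟩
  have hC : ((C₁ + C₂).toNNReal : ℝ≥0∞) = C₁ + C₂ :=
    ENNReal.coe_toNNReal (ENNReal.add_ne_top.2 ⟨hC₁t, hC₂t⟩)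
  rw [hC]
  have hw := OneSided.aemeasurable_toWeight hloc
  have hwt : ∀ x, OneSided.toWeight w x ≠ ∞ := fun x => ENNReal.ofReal_ne_top
  have hwl := OneSided.setLIntegral_toWeight_ne_top hloc
  rw [OneSided.dualWeight_eq hp]
  have hKt := OneSided.aInftyMinusConst_dual_ne_top hp hw hwt hA.ne
  set K := OneSided.aInftyMinusConst (fun x => OneSided.toWeight w x ^ (-1 / (p - 1)))
  set A := OneSided.apPlusConst p (OneSided.toWeight w)
  set μ := volume.withDensity (OneSided.toWeight w) with hμ
  have hge : ENNReal.ofReal p ≤ q → ∀ f : ℝ → ℂ, AEStronglyMeasurable f μ →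
      OneSided.lorentzNorm p q μ (OneSided.maximalPlus f) ≤
        (C₁ + C₂) * K ^ (1 / p) * A ^ (1 / p) * OneSided.lorentzNorm p q μ f := by
    intro hpq f hf
    -- The null weight is treated apart, since `K ≥ 1` is derived from the existence of a point with
    -- `w`-mass on its left.
    rcases eq_or_ne μ 0 with h0 | h0
    · rw [h0, OneSided.lorentzNorm_zero_measure hp0 hq]
      exact zero_le
    refine (OneSided.lorentzNorm_maximalPlus_le_of_ge hp hpq hw hwt hwl hA.ne h0 hf).trans ?_
    refine mul_le_mul_left ?_ _
    calc 2 * (B * A * (D₁ * K)) ^ (1 / p) = C₁ * K ^ (1 / p) * A ^ (1 / p) := by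
          rw [hC₁, show B * A * (D₁ * K) = B * D₁ * K * A by ring,
            ENNReal.mul_rpow_of_nonneg (B * D₁ * K) _ hpi,
            ENNReal.mul_rpow_of_nonneg (B * D₁) _ hpi]
          ring
      _ ≤ _ := by
          gcongr
          exact le_self_add
  have hle : q ≤ ENNReal.ofReal p → ∀ f : ℝ → ℂ, AEStronglyMeasurable f μ →
      OneSided.lorentzNorm p q μ (OneSided.maximalPlus f) ≤
        (C₁ + C₂) * K ^ (1 / q.toReal) * A ^ (1 / p) * OneSided.lorentzNorm p q μ f := by
    intro hqp f hf
    rcases eq_or_ne μ 0 with h0 | h0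
    · rw [h0, OneSided.lorentzNorm_zero_measure hp0 hq]
      exact zero_le
    refine (OneSided.lorentzNorm_maximalPlus_le_of_le hp hq hqp hw hwt hwl hA.ne h0 hf).trans ?_
    refine mul_le_mul_left ?_ _
    calc 2 * (B * A) ^ (1 / p) * (D₂ * K) ^ (1 / q.toReal)
        = C₂ * K ^ (1 / q.toReal) * A ^ (1 / p) := by
          rw [hC₂, ENNReal.mul_rpow_of_nonneg B _ hpi, ENNReal.mul_rpow_of_nonneg D₂ _ hqi]
          ring
      _ ≤ _ := by
          gcongr
          exact le_add_self
  have hfin : ∃ L : ℝ≥0∞, L ≠ ∞ ∧ ∀ f : ℝ → ℂ, AEStronglyMeasurable f μ →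
      OneSided.lorentzNorm p q μ (OneSided.maximalPlus f) ≤
        L * OneSided.lorentzNorm p q μ f := by
    have hne : ∀ s : ℝ, 0 ≤ s → (C₁ + C₂) * K ^ s * A ^ (1 / p) ≠ ∞ := fun s hs =>
      ENNReal.mul_ne_top (ENNReal.mul_ne_top (ENNReal.add_ne_top.2 ⟨hC₁t, hC₂t⟩)
        (ENNReal.rpow_ne_top_of_nonneg hs hKt)) (ENNReal.rpow_ne_top_of_nonneg hpi hA.ne)
    rcases le_total (ENNReal.ofReal p) q with h | h
    · exact ⟨_, hne _ hpi, hge h⟩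
    · exact ⟨_, hne _ hqi, hle h⟩
  obtain ⟨L, hLt, hL⟩ := hfin
  refine ⟨fun f hf => ⟨?_, ?_⟩, ?_, fun h => ?_, fun h => ?_⟩
  · rw [← OneSided.maximalPlus_enorm]
    exact (OneSided.measurable_maximalPlus _).aestronglyMeasurable
  · exact (hL f hf.1).trans_lt (ENNReal.mul_lt_top hLt.lt_top hf.2)
  · exact lt_of_le_of_lt (sInf_le fun f hf => hL f hf.1) hLt.lt_top
  · exact sInf_le fun f hf => hge h f hf.1
  · exact sInf_le fun f hf => hle h f hf.1
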